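/- Let $n\ge 1$, $d,\ell\in\mathbb N$. An oracle $\mathcal O$ (stateful, randomized, computationally unbounded) holds a set $x\subseteq\{0,1\}^d$ of $n$ points and answers each query $q:\{0,1\}^d\to[-1,1]$ by a number in $[-1,1]$. In the game $\mathsf{NonPrivacy}_{n,d,\ell}[\mathcal O,\mathcal A]$ a stateful randomized adversary $\mathcal A$ chooses a set $y=\{y_1,\dots,y_{2n}\}\subseteq\{0,1\}^d$ of $2n$ distinct points; a uniformly random subset $x\subseteq y$ of size $n$ is given to $\mathcal O$; for $j=1,\dots,\ell$, $\mathcal A$ asks a query $q^j$ and $\mathcal O$ answers $a^j$ (both may depend on the history); finally $\mathcal A$ outputs a set $x'\subseteq y$. A run is called *$(\alpha,\beta)$-accurate* if $|a^j-\frac1n\sum_{z\in x}q^j(z)|\le\alpha$ for at least $(1-\beta)\ell$ of the indices $j$. The oracle is *$(\alpha,\beta,\gamma)$-sample-accurate* for $\ell$ adaptively chosen queries given $n$ samples in $\{0,1\}^d$ if, for every adversary, the run is $(\alpha,\beta)$-accurate with probability at least $1-\gamma$. A family of oracles, one for each $n$, is *blatantly non-private* if there are adversaries for which $\Pr[\,|x\triangle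 x'|>n/100\,]\le o_n(1)$. **Theorem.** There are a function $\ell(2n,\beta)=O\big(n^2/(\tfrac12-\beta)^4\big)$ (with an absolute constant, for $n\ge1$ and $0\le\beta<\frac12$) and a function $\varepsilon(\beta,n)$ with $\lim_{n\to\infty}\varepsilon(\beta,n)=0$ for every $\beta\in[0,\frac12)$, such that the following holds for $\ell=\ell(2n,\beta)$. 1. Let $n\ge1$, $0\le\beta<\frac12$, $d\ge\ell(2n,\beta)$ and $\gamma\in\mathbb R$ (for instance $\gamma=\frac12$). For every oracle $\mathcal O$, even a computationally unbounded one, that is $(1/1000,\beta,\gamma)$-sample-accurate for $\ell(2n,\beta)$ adaptively chosen queries given $n$ samples in $\{0,1\}^d$, there is an adversary such that in the game $\mathsf{NonPrivacy}_{n,d,\ell}$ $$\Pr\big[\text{the run is }(1/1000,\beta)\text{-accurate and }|x\triangle x'|>n/100\big]\le\varepsilon(\beta,n)\quad\text{and}\quad \Pr\big[|x\triangle x'|>n/100\big]\le\gamma+\varepsilon(\beta,n).$$ 2. Consequently, if $0\le\beta<\frac12$, $d(n)\ge\ell(2n,\beta)$ and $\gamma(n)\to0$, then every family of oracles whose $n$-th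 member is $(1/1000,\beta,\gamma(n))$-sample-accurate for $\ell(2n,\beta)$ adaptively chosen queries given $n$ samples in $\{0,1\}^{d(n)}$ is blatantly non-private. -/

import Mathlib

universe u

/-- The data universe `{0,1}^d`. -/
abbrev Cube (d : ℕ) : Type := Fin d → Bool

/-- Answers are real numbers in `[-1,1]`. -/
abbrev Answer : Type := Set.Icc (-1 : ℝ) 1

/-- A statistical query is a function `{0,1}^d → [-1,1]`. -/
abbrev Query (d : ℕ) : Type := Cube d → Set.Icc (-1 : ℝ) 1

/-- A stateful, randomized, computationally unbounded oracle for data in `{0,1}^d`.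
Its coins are a point of an arbitrary probability space, drawn once. Its answer in round `j`
(rounds are numbered from `0`) is an arbitrary function of the coins, of the sample set it holds,
and of the queries of rounds `0, …, j`; the earlier answers, and hence any internal state,
are determined by these data. -/
structure Oracle (d : ℕ) where
  Coins : Type u
  [measurableSpace : MeasurableSpace Coins]
  law : MeasureTheory.Measure Coins
  [isProbabilityMeasure : MeasureTheory.IsProbabilityMeasure law]
  respond : (j : ℕ) → Coins → Finset (Cube d) → (Fin (j + 1) → Query d) → Answer
  measurable_respond : ∀ (j : ℕ) (x : Finset (Cube d)),
    Measurable fun p : Coins × (Fin (j + 1) → Query d) => respond j p.1 x p.2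

attribute [instance] Oracle.measurableSpace Oracle.isProbabilityMeasure

/-- A stateful, randomized adversary in the non-privacy game with `ℓ` rounds: it chooses
`2n` distinct points `y_1, …, y_{2n}` of `{0,1}^d`, then asks queries that may depend on the
answers received so far, and at the end outputs a set `x' ⊆ y`. -/
structure Adversary (n d ℓ : ℕ) where
  Coins : Type
  [measurableSpace : MeasurableSpace Coins]
  law : MeasureTheory.Measure Coins
  [isProbabilityMeasure : MeasureTheory.IsProbabilityMeasure law]
  points : Coins → Fin (2 * n) → Cube d
  points_injective : ∀ ω, Function.Injective (points ω)
  measurable_points : Measurable points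
  ask : (j : ℕ) → Coins → (Fin j → Answer) → Query d
  measurable_ask : ∀ j : ℕ, Measurable fun p : Coins × (Fin j → Answer) => ask j p.1 p.2
  output : Coins → (Fin ℓ → Answer) → Finset (Cube d)
  output_subset : ∀ ω a, output ω a ⊆ Finset.univ.image (points ω)
  measurable_output : ∀ z : Cube d,
    MeasurableSet {p : Coins × (Fin ℓ → Answer) | z ∈ output p.1 p.2}

attribute [instance] Adversary.measurableSpace Adversary.isProbabilityMeasure

namespace NonPrivacy

variable {n d ℓ : ℕ}

/-- The answers and the queries of the first `j` rounds of the game in which the oracle, with coins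
`ω`, holds the sample `x`, and the adversary has coins `η`. -/
def transcript (O : Oracle.{u} d) (A : Adversary n d ℓ) (ω : O.Coins) (η : A.Coins)
    (x : Finset (Cube d)) : (j : ℕ) → (Fin j → Answer) × (Fin j → Query d)
  | 0 => (Fin.elim0, Fin.elim0)
  | j + 1 =>
    let h := transcript O A ω η x j
    let queries : Fin (j + 1) → Query d := Fin.snoc h.2 (A.ask j η h.1)
    (Fin.snoc h.1 (O.respond j ω x queries), queries)

/-- The sample `x = {y_i : i ∈ S}`. -/
def sample (A : Adversary n d ℓ) (η : A.Coins) (S : Finset (Fin (2 * n))) : Finset (Cube d) :=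
  S.image (A.points η)

/-- The probability of an event in the non-privacy game: the coins `ω` of the oracle, the coins `η`
of the adversary and the set `S` of the `n` sampled indices (uniform among the `n`-element subsets
of the `2n` indices) are independent. -/
noncomputable def prob (O : Oracle.{u} d) (A : Adversary n d ℓ)
    (E : O.Coins → A.Coins → Finset (Fin (2 * n)) → Prop) : ℝ :=
  (∑ S ∈ Finset.powersetCard n (Finset.univ : Finset (Fin (2 * n))),
      (O.law.prod A.law).real {p | E p.1 p.2 S}) /
    ((Finset.powersetCard n (Finset.univ : Finset (Fin (2 * n)))).card : ℝ)

/-- The average `q(x)` of a query over a sample `x`. -/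
noncomputable def average (q : Query d) (x : Finset (Cube d)) : ℝ :=
  (∑ z ∈ x, (q z : ℝ)) / (x.card : ℝ)

/-- For at least `(1 - β) ℓ` of the rounds, the answer is within `α` of the sample average. -/
def AccurateRun (O : Oracle.{u} d) (A : Adversary n d ℓ) (α β : ℝ)
    (ω : O.Coins) (η : A.Coins) (S : Finset (Fin (2 * n))) : Prop :=
  let x := sample A η S
  let t := transcript O A ω η x ℓ
  (1 - β) * (ℓ : ℝ) ≤ ({j : Fin ℓ | |(t.1 j : ℝ) - average (t.2 j) x| ≤ α}.ncard : ℝ)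

/-- The output `x'` of the adversary satisfies `|x ∆ x'| > n / 100`. -/
def ReconstructionFails (O : Oracle.{u} d) (A : Adversary n d ℓ)
    (ω : O.Coins) (η : A.Coins) (S : Finset (Fin (2 * n))) : Prop :=
  let x := sample A η S
  let x' := A.output η (transcript O A ω η x ℓ).1
  (n : ℝ) / 100 < ((symmDiff x x').card : ℝ)

end NonPrivacy

/-- `O` is `(α, β, γ)`-sample-accurate for `ℓ` adaptively chosen queries given `n` samples in
`{0,1}^d`. -/
def SampleAccurate {d : ℕ} (O : Oracle.{u} d) (n ℓ : ℕ) (α β γ : ℝ) : Prop :=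
  ∀ A : Adversary n d ℓ, 1 - γ ≤ NonPrivacy.prob O A (NonPrivacy.AccurateRun O A α β)

/-- A family of oracles (the `n`-th one holding `n` samples in `{0,1}^{d n}` and answering `ℓ n`
queries) is blatantly non-private: some adversary reconstructs the sample up to symmetric
difference `n / 100` except with probability `o_n(1)`. -/
def BlatantlyNonPrivate (d ℓ : ℕ → ℕ) (O : (n : ℕ) → Oracle.{u} (d n)) : Prop :=
  ∃ err : ℕ → ℝ, Filter.Tendsto err Filter.atTop (nhds 0) ∧
    ∀ n : ℕ, 1 ≤ n → ∃ A : Adversary n (d n) (ℓ n),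
      NonPrivacy.prob (O n) A (NonPrivacy.ReconstructionFails (O n) A) ≤ err n

/-! The attack runs an interactive fingerprinting code. Each of the `2n` users owns a data point
that carries its index and a secret key. In a round every user gets a bit, which the query encrypts
with that user's key, so an oracle that holds the points of `S` can read the bits of the users of
`S` only. Most rounds are constant: all users get one bit `b`, and an accurate answer must then have
the sign of `b`. A fraction `ν` of the rounds is noisy: the bits are independent of mean `sin² θ`,
with `θ` drawn from a fine grid. The oracle sees bits, not the kind of the round. A user's score
adds up, over noisy rounds, the sign of the answer times the logarithmic derivative in `θ` of the
law of the user's bit. A user whose score exceeds `σ` is accused and gets the value zero from then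
on.

Users outside `S`: the key is a one-time pad, so after masking the keys (`coinLaw_le`) the sign of
an answer does not depend on the current bits of these users (`causal_maskedSign`). Their scores are
martingales, the sum of the squares of the scores concentrates (`Causal.wProb_sum_total_sq_le`), and
few of them are accused.

Users of `S`: summed over all users, the score is the logarithmic derivative of the joint law of the
bits. Averaging over `θ`, the correlation of the total score with any bounded statistic `f` of the
bits integrates a derivative, and so is proportional to `f(1,…,1) - f(0,…,0)` up to a small error
(`exists_code`). Correct signs in constant rounds therefore force the scores of `S` upwards.
Freezing caps their sum at `n (σ + B)`, so with high probability the sign is wrong in more than `βℓ`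
constant rounds (`Causal.wProb_wrongCount_le`).

These facts collide. If the run is accurate, reconstruction fails and false accusations are few,
then more than `n/200` users of `S` stay active to the end; every constant query has an average of
size above `1/200`, and accuracy `1/1000` forces the right sign in all but `βℓ` rounds
(`accurate_and_fails`). The estimates hold for each fixed `S` and fixed coins of the oracle, so its
computational power plays no role. -/

open Finset Function MeasureTheory

namespace Fingerprint

/-! ### Finite product measures: resampling, martingale differences, Chebyshev -/

section WeightedExpectation

variable {ι X : Type*} [Fintype ι] [DecidableEq ι] [Fintype X]

/-- The expectation of `F` when the coordinates of its argument are independent, each with the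
weights `w`. -/
def wExp (w : X → ℝ) (F : (ι → X) → ℝ) : ℝ := ∑ x, (∏ j, w (x j)) * F x

variable {w : X → ℝ}

lemma wExp_add (F G : (ι → X) → ℝ) :
    wExp w (fun x => F x + G x) = wExp w F + wExp w G := by
  simp [wExp, mul_add, sum_add_distrib]

lemma wExp_sub (F G : (ι → X) → ℝ) :
    wExp w (fun x => F x - G x) = wExp w F - wExp w G := by
  simp [wExp, mul_sub, sum_sub_distrib]

lemma wExp_const_mul (a : ℝ) (F : (ι → X) → ℝ) :
    wExp w (fun x => a * F x) = a * wExp w F := by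
  simp only [wExp, mul_sum]
  exact sum_congr rfl fun x _ => by ring

lemma wExp_sum {κ : Type*} (s : Finset κ) (F : κ → (ι → X) → ℝ) :
    wExp w (fun x => ∑ k ∈ s, F k x) = ∑ k ∈ s, wExp w (F k) := by
  simp only [wExp, mul_sum]
  exact sum_comm

lemma wExp_one (hw : ∑ y, w y = 1) : wExp w (fun _ : ι → X => 1) = 1 := by
  have := Finset.prod_univ_sum (fun _ : ι => (univ : Finset X)) (fun _ y => w y)
  simp only [hw, prod_const_one, Fintype.piFinset_univ] at this
  simp [wExp, ← this]

lemma wExp_const (hw : ∑ y, w y = 1) (a : ℝ) : wExp w (fun _ : ι → X => a) = a := by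
  have := wExp_const_mul (w := w) a (fun _ : ι → X => 1)
  simpa [wExp_one hw] using this

lemma wExp_mono (h0 : ∀ y, 0 ≤ w y) {F G : (ι → X) → ℝ} (h : ∀ x, F x ≤ G x) :
    wExp w F ≤ wExp w G :=
  sum_le_sum fun x _ => mul_le_mul_of_nonneg_left (h x) (prod_nonneg fun _ _ => h0 _)

lemma abs_wExp_le (h0 : ∀ y, 0 ≤ w y) (F : (ι → X) → ℝ) :
    |wExp w F| ≤ wExp w (fun x => |F x|) := by
  refine (abs_sum_le_sum_abs _ _).trans_eq (sum_congr rfl fun x _ => ?_)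
  rw [abs_mul, abs_of_nonneg (prod_nonneg fun _ _ => h0 _)]

/-- Redrawing one coordinate does not change an expectation. -/
lemma wExp_resample (hw : ∑ y, w y = 1) (j : ι) (F : (ι → X) → ℝ) :
    wExp w F = wExp w (fun x => ∑ y, w y * F (update x j y)) := by
  classical
  have key : ∑ q : (ι → X) × X, (∏ k, w (q.1 k)) * w q.2 * F (update q.1 j q.2) =
      ∑ q : (ι → X) × X, (∏ k, w (q.1 k)) * w q.2 * F q.1 := by
    -- Exchanging `x j` with the fresh value `y` preserves the joint weight of `(x, y)`.
    have hinv : Involutive (fun q : (ι → X) × X => (update q.1 j q.2, q.1 j)) := by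
      rintro ⟨x, y⟩; simp
    refine Fintype.sum_equiv hinv.toPerm _ _ ?_
    rintro ⟨x, y⟩
    simp only [Involutive.coe_toPerm]
    congr 1
    rw [← mul_prod_erase univ _ (mem_univ j), ← mul_prod_erase univ _ (mem_univ j)]
    have : ∏ k ∈ univ.erase j, w (update x j y k) = ∏ k ∈ univ.erase j, w (x k) :=
      prod_congr rfl fun k hk => by rw [update_of_ne (ne_of_mem_erase hk)]
    rw [this, update_self]
    ring
  rw [Fintype.sum_prod_type, Fintype.sum_prod_type] at key
  simp only [wExp, mul_sum]
  calc ∑ x, (∏ k, w (x k)) * F x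
      = ∑ x : ι → X, ∑ y, (∏ k, w (x k)) * w y * F x := by
        refine sum_congr rfl fun x _ => ?_
        rw [← sum_mul, ← mul_sum, hw, mul_one]
    _ = _ := key.symm
    _ = _ := sum_congr rfl fun x _ => sum_congr rfl fun y _ => by ring

lemma wExp_eq_zero_of_resample (hw : ∑ y, w y = 1) (j : ι) {F : (ι → X) → ℝ}
    (h : ∀ x, ∑ y, w y * F (update x j y) = 0) : wExp w F = 0 := by
  rw [wExp_resample hw j, funext h]
  simp [wExp]

lemma wExp_le_of_resample (h0 : ∀ y, 0 ≤ w y) (hw : ∑ y, w y = 1) (j : ι)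
    {F G : (ι → X) → ℝ} (h : ∀ x, ∑ y, w y * F (update x j y) ≤ G x) :
    wExp w F ≤ wExp w G := by
  rw [wExp_resample hw j]
  exact wExp_mono h0 h

/-- Functions of a single coordinate. -/
lemma wExp_apply (hw : ∑ y, w y = 1) (j : ι) (f : X → ℝ) :
    wExp w (fun x : ι → X => f (x j)) = ∑ y, w y * f y := by
  rw [wExp_resample hw j]
  simp [wExp_const hw]

/-- Martingale differences are orthogonal. -/
lemma wExp_sq_sum [LinearOrder ι] (hw : ∑ y, w y = 1) (D : ι → (ι → X) → ℝ)
    (adapted : ∀ i j, i < j → ∀ x y, D i (update x j y) = D i x)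
    (mean : ∀ j x, ∑ y, w y * D j (update x j y) = 0) (s : Finset ι) :
    wExp w (fun x => (∑ j ∈ s, D j x) ^ 2) = ∑ j ∈ s, wExp w (fun x => D j x ^ 2) := by
  have cross : ∀ i j, i < j → wExp w (fun x => D i x * D j x) = 0 := by
    intro i j hij
    -- Redraw the later coordinate: the earlier difference does not see it, and the later one
    -- averages to zero.
    refine wExp_eq_zero_of_resample hw j fun x => ?_
    calc ∑ y, w y * (D i (update x j y) * D j (update x j y))
        = D i x * ∑ y, w y * D j (update x j y) := by
          rw [mul_sum]
          exact sum_congr rfl fun y _ => by rw [adapted i j hij]; ring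
      _ = 0 := by rw [mean, mul_zero]
  simp only [sq, sum_mul_sum, wExp_sum]
  refine sum_congr rfl fun i hi => ?_
  refine sum_eq_single_of_mem i hi fun j _ hji => ?_
  rcases lt_or_gt_of_ne hji with h | h
  · rw [← cross j i h]; simp only [mul_comm]
  · exact cross i j h

open Classical in
/-- The probability of an event under product weights. -/
noncomputable def wProb (w : X → ℝ) (P : (ι → X) → Prop) : ℝ := wExp w (fun x => if P x then 1 else 0)

/-- Implications between events are needed on the support only: that all bits of a constant round
agree fails for outcomes of weight zero. -/
lemma wProb_mono_of_ne_zero (h0 : ∀ y, 0 ≤ w y) {P Q : (ι → X) → Prop}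
    (h : ∀ x, (∀ j, w (x j) ≠ 0) → P x → Q x) : wProb w P ≤ wProb w Q := by
  classical
  refine sum_le_sum fun x _ => ?_
  by_cases hx : ∀ j, w (x j) ≠ 0
  · refine mul_le_mul_of_nonneg_left ?_ (prod_nonneg fun _ _ => h0 _)
    by_cases hP : P x
    · simp [hP, h x hx hP]
    · by_cases hQ : Q x <;> simp [hP, hQ]
  · obtain ⟨j, hj⟩ := not_forall.1 hx
    rw [prod_eq_zero (mem_univ j) (not_not.1 hj), zero_mul, zero_mul]

lemma wProb_mono (h0 : ∀ y, 0 ≤ w y) {P Q : (ι → X) → Prop} (h : ∀ x, P x → Q x) :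
    wProb w P ≤ wProb w Q :=
  wProb_mono_of_ne_zero h0 fun x _ => h x

lemma wProb_or_le (h0 : ∀ y, 0 ≤ w y) (P Q : (ι → X) → Prop) :
    wProb w (fun x => P x ∨ Q x) ≤ wProb w P + wProb w Q := by
  classical
  unfold wProb
  rw [← wExp_add]
  refine wExp_mono h0 fun x => ?_
  by_cases hP : P x <;> by_cases hQ : Q x <;> simp [hP, hQ]

lemma wProb_le_of_sq (h0 : ∀ y, 0 ≤ w y) {F : (ι → X) → ℝ} {t v : ℝ} (ht : 0 < t)
    (hv : wExp w (fun x => F x ^ 2) ≤ v) : wProb w (fun x => t ≤ |F x|) ≤ v / t ^ 2 := by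
  classical
  have : wProb w (fun x => t ≤ |F x|) ≤ wExp w (fun x => (1 / t ^ 2) * F x ^ 2) := by
    refine wExp_mono h0 fun x => ?_
    split_ifs with h
    · rw [one_div, inv_mul_eq_div, one_le_div (by positivity), ← sq_abs (F x)]
      gcongr
    · positivity
  rw [wExp_const_mul] at this
  calc _ ≤ _ := this
    _ ≤ 1 / t ^ 2 * v := by gcongr
    _ = _ := by ring

/-- Chebyshev's inequality for a sum of adapted variables around the sum of their conditional
means. -/
lemma wProb_sum_sub_mean_le [LinearOrder ι] (h0 : ∀ y, 0 ≤ w y) (hw : ∑ y, w y = 1)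
    (Y : ι → (ι → X) → ℝ)
    (adapted : ∀ i j, i < j → ∀ x y, Y i (update x j y) = Y i x)
    {v t : ℝ} (ht : 0 < t) (hv : ∀ j, wExp w (fun x => Y j x ^ 2) ≤ v) :
    wProb w (fun x => t ≤ |∑ j, (Y j x - ∑ y, w y * Y j (update x j y))|) ≤
      Fintype.card ι * v / t ^ 2 := by
  refine wProb_le_of_sq h0 ht ?_
  have hmean : ∀ j x, ∑ y, w y * (Y j (update x j y) -
      ∑ z, w z * Y j (update (update x j y) j z)) = 0 := by
    intro j x
    simp [mul_sub, sum_sub_distrib, ← sum_mul, hw]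
  rw [wExp_sq_sum hw (fun j x => Y j x - ∑ y, w y * Y j (update x j y)) ?_ hmean]
  · rw [← nsmul_eq_mul, ← card_univ]
    refine sum_le_card_nsmul _ _ _ fun j _ => le_trans ?_ (hv j)
    -- Pythagoras: the deviation from the conditional mean is orthogonal to that mean, so its second
    -- moment is at most that of `Y j`.
    have hsplit : ∀ x : ι → X, (Y j x - ∑ y, w y * Y j (update x j y)) ^ 2 =
        Y j x ^ 2 - (∑ y, w y * Y j (update x j y)) ^ 2
          - 2 * ((∑ y, w y * Y j (update x j y)) *
            (Y j x - ∑ y, w y * Y j (update x j y))) := by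
      intro x; ring
    have hz : wExp w (fun x => (∑ y, w y * Y j (update x j y)) *
            (Y j x - ∑ y, w y * Y j (update x j y))) = 0 := by
      refine wExp_eq_zero_of_resample hw j fun x => ?_
      have := hmean j x
      simp only [update_idem] at this ⊢
      calc _ = (∑ y, w y * Y j (update x j y)) * ∑ y, w y * (Y j (update x j y) -
              ∑ z, w z * Y j (update x j z)) := by
            rw [mul_sum]
            exact sum_congr rfl fun y _ => by ring
        _ = 0 := by rw [this, mul_zero]
    rw [funext hsplit, wExp_sub, wExp_sub, wExp_const_mul, hz]
    have : 0 ≤ wExp w (fun x => (∑ y, w y * Y j (update x j y)) ^ 2) := by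
      have := wExp_mono (ι := ι) h0 (F := fun _ => 0)
        (G := fun x => (∑ y, w y * Y j (update x j y)) ^ 2) fun x => sq_nonneg _
      simpa [wExp] using this
    linarith
  · intro i j hij x y
    simp only [adapted i j hij]
    congr 1
    refine sum_congr rfl fun z _ => ?_
    rw [update_comm hij.ne', adapted i j hij]

end WeightedExpectation

/-! ### Bernoulli bits and the one-round code -/

/-- The weights of a Bernoulli variable. -/
def bern (p : ℝ) (b : Bool) : ℝ := if b then p else 1 - p

lemma bern_nonneg {p : ℝ} (h0 : 0 ≤ p) (h1 : p ≤ 1) (b : Bool) : 0 ≤ bern p b := by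
  cases b <;> simp [bern, h0, h1]

lemma sum_bern (p : ℝ) : ∑ b, bern p b = 1 := by simp [bern]

lemma wExp_bern_zero {N : ℕ} (F : (Fin N → Bool) → ℝ) :
    wExp (bern 0) F = F (fun _ => false) := by
  unfold wExp
  rw [sum_eq_single (fun _ => false)]
  · simp [bern]
  · intro c _ hc
    obtain ⟨i, hi⟩ := Function.ne_iff.1 hc
    rw [prod_eq_zero (mem_univ i), zero_mul]
    simp only [ne_eq, Bool.not_eq_false] at hi
    simp [bern, hi]
  · simp

lemma wExp_bern_one {N : ℕ} (F : (Fin N → Bool) → ℝ) :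
    wExp (bern 1) F = F (fun _ => true) := by
  unfold wExp
  rw [sum_eq_single (fun _ => true)]
  · simp [bern]
  · intro c _ hc
    obtain ⟨i, hi⟩ := Function.ne_iff.1 hc
    rw [prod_eq_zero (mem_univ i), zero_mul]
    simp only [ne_eq, Bool.not_eq_true] at hi
    simp [bern, hi]
  · simp

/-- The distribution of one round of an interactive fingerprinting code for `N` users: the round is
constant (all users get the bit `b`) or it is one of finitely many noisy rounds `k`, in which the
users get independent bits of mean `bias k`. The score of a bit has mean zero, variance at most `4`,
and, in total over the users, a correlation with every bounded statistic `f` of the bits that is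
governed by the values of `f` on constant rounds. -/
structure Code (N : ℕ) (ν lam err B : ℝ) where
  K : ℕ
  wt : Bool ⊕ Fin K → ℝ
  bias : Bool ⊕ Fin K → ℝ
  score : Bool ⊕ Fin K → Bool → ℝ
  wt_nonneg : ∀ τ, 0 ≤ wt τ
  wt_sum : ∑ τ, wt τ = 1
  wt_noisy : ∑ k, wt (.inr k) = ν
  bias_nonneg : ∀ τ, 0 ≤ bias τ
  bias_le_one : ∀ τ, bias τ ≤ 1
  bias_const : ∀ b, bias (.inl b) = if b then 1 else 0
  score_const : ∀ b c, score (.inl b) c = 0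
  score_mean : ∀ τ, ∑ b, bern (bias τ) b * score τ b = 0
  score_sq : ∀ τ, ∑ b, bern (bias τ) b * score τ b ^ 2 ≤ 4
  abs_score_le : ∀ τ b, |score τ b| ≤ B
  correlation : ∀ f : (Fin N → Bool) → ℝ, (∀ c, |f c| ≤ 1) →
    |∑ τ, wt τ * wExp (bern (bias τ)) (fun c => f c * ∑ i, score τ (c i)) -
      lam * (wt (.inl true) * f (fun _ => true) - wt (.inl false) * f (fun _ => false))| ≤ err

/-! ### Construction of the code from the angle parametrization -/

/-- Left Riemann sums of a derivative. -/
lemma exists_riemann_sum_near {f : ℝ → ℝ} (hf : ContDiff ℝ 1 f) {a b ε : ℝ} (hab : a < b)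
    (hε : 0 < ε) : ∃ K₀ : ℕ, ∀ K : ℕ, K₀ ≤ K → 1 ≤ K →
      |(b - a) / K * ∑ k : Fin K, deriv f (a + k * ((b - a) / K)) - (f b - f a)| ≤ ε := by
  have hL : 0 < b - a := sub_pos.2 hab
  have huc := isCompact_Icc (a := a) (b := b) |>.uniformContinuousOn_of_continuous
    (hf.continuous_deriv le_rfl).continuousOn
  obtain ⟨r, hr, hr'⟩ := Metric.uniformContinuousOn_iff.1 huc (ε / (b - a)) (by positivity)
  obtain ⟨K₀, hK₀⟩ := exists_nat_gt ((b - a) / r)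
  refine ⟨K₀, fun K hK hK1 => ?_⟩
  have hKpos : (0 : ℝ) < K := by exact_mod_cast hK1
  set h := (b - a) / K with hh
  have hhpos : 0 < h := by positivity
  have hhr : h < r := by
    have : (K₀ : ℝ) ≤ K := by exact_mod_cast hK
    rw [hh, div_lt_iff₀ hKpos]
    rw [div_lt_iff₀ hr] at hK₀
    nlinarith
  have hKh : K * h = b - a := by rw [hh]; field_simp
  have htel : f b - f a = ∑ k ∈ range K, (f (a + (k + 1 : ℕ) * h) - f (a + k * h)) := by
    rw [sum_range_sub (fun k : ℕ => f (a + k * h)), hKh]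
    simp
  rw [Fin.sum_univ_eq_sum_range (fun k => deriv f (a + k * h)), htel, mul_sum,
    ← sum_sub_distrib]
  refine (abs_sum_le_sum_abs _ _).trans ?_
  have hstep : ∀ k ∈ range K,
      |h * deriv f (a + k * h) - (f (a + (k + 1 : ℕ) * h) - f (a + k * h))| ≤ ε / K := by
    intro k hk
    have hkK : ((k + 1 : ℕ) : ℝ) ≤ K := by exact_mod_cast mem_range.1 hk
    have hlt : a + k * h < a + (k + 1 : ℕ) * h := by push_cast; linarith
    -- On each cell the increment of `f` is `h` times the derivative at an intermediate point, which
    -- uniform continuity compares with the left endpoint.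
    obtain ⟨ξ, hξ, hξ'⟩ := exists_deriv_eq_slope f hlt hf.continuous.continuousOn
      (hf.differentiable one_ne_zero).differentiableOn
    have hwidth : a + (k + 1 : ℕ) * h - (a + k * h) = h := by push_cast; ring
    rw [hwidth, eq_div_iff hhpos.ne'] at hξ'
    have hend : a + (k + 1 : ℕ) * h ≤ b := by
      have := mul_le_mul_of_nonneg_right hkK hhpos.le
      linarith
    have hkh : 0 ≤ k * h := by positivity
    have hd := hr' (a + k * h) ⟨by linarith, by linarith⟩ ξ ⟨by linarith [hξ.1], by linarith [hξ.2]⟩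
      (by rw [Real.dist_eq, abs_sub_comm, abs_of_pos (by linarith [hξ.1])]; linarith [hξ.2])
    rw [Real.dist_eq] at hd
    rw [← hξ', mul_comm (deriv f ξ), ← mul_sub, abs_mul, abs_of_pos hhpos]
    calc h * _ ≤ h * (ε / (b - a)) := by gcongr
      _ = ε / K := by rw [hh]; field_simp
  refine (sum_le_sum hstep).trans_eq ?_
  rw [sum_const, card_range, nsmul_eq_mul]
  field_simp

/-- The logarithmic derivative in `θ` of the weights `sin² θ`, `cos² θ`. -/
noncomputable def trigScore (θ : ℝ) (b : Bool) : ℝ :=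
  if b then 2 * (Real.cos θ / Real.sin θ) else -(2 * (Real.sin θ / Real.cos θ))

lemma hasDerivAt_bern_sin_sq {θ : ℝ} (hc : Real.cos θ ≠ 0) (b : Bool) :
    HasDerivAt (fun θ => bern (Real.sin θ ^ 2) b) (bern (Real.sin θ ^ 2) b * trigScore θ b) θ := by
  have h := (Real.hasDerivAt_sin θ).pow 2
  cases b
  · simp only [bern, trigScore, Bool.false_eq_true, if_false]
    have h' : HasDerivAt (fun θ => 1 - Real.sin θ ^ 2) _ θ := h.const_sub 1
    convert h' using 1
    rw [← Real.cos_sq']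
    field_simp
    norm_num
  · simp only [bern, trigScore, if_true]
    have h' : HasDerivAt (fun θ => Real.sin θ ^ 2) _ θ := h
    convert h' using 1
    field_simp
    norm_num [mul_comm]

/-- The logarithmic derivative of a product is a sum. This is what turns the correlation of a
statistic with the total score into the `θ`-derivative of its expectation. -/
lemma hasDerivAt_prod_bern {N : ℕ} {θ : ℝ} (hc : Real.cos θ ≠ 0)
    (c : Fin N → Bool) :
    HasDerivAt (fun θ => ∏ i, bern (Real.sin θ ^ 2) (c i))
      ((∏ i, bern (Real.sin θ ^ 2) (c i)) * ∑ i, trigScore θ (c i)) θ := by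
  refine (HasDerivAt.fun_finsetProd (u := univ)
    (fun i _ => hasDerivAt_bern_sin_sq hc (c i))).congr_deriv ?_
  rw [mul_sum]
  refine sum_congr rfl fun i _ => ?_
  rw [smul_eq_mul, ← mul_prod_erase univ _ (mem_univ i)]
  ring

lemma contDiff_prod_bern {N : ℕ} (c : Fin N → Bool) :
    ContDiff ℝ 1 (fun θ : ℝ => ∏ i, bern (Real.sin θ ^ 2) (c i)) := by
  refine contDiff_prod fun i _ => ?_
  cases c i
  · simp only [bern, Bool.false_eq_true, if_false]; fun_prop
  · simp only [bern, if_true]; fun_prop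

/-- Union bound: some bit is `true` with probability at most `N * p`, and two values of `f` differ
by at most `2`. -/
lemma abs_wExp_bern_sub_false {N : ℕ} {p : ℝ} (h0 : 0 ≤ p) (h1 : p ≤ 1)
    {f : (Fin N → Bool) → ℝ} (hf : ∀ c, |f c| ≤ 1) :
    |wExp (bern p) f - f (fun _ => false)| ≤ 2 * N * p := by
  rw [← wExp_const (ι := Fin N) (sum_bern p) (f fun _ => false), ← wExp_sub]
  refine (abs_wExp_le (bern_nonneg h0 h1) _).trans ?_
  calc _ ≤ wExp (bern p) (fun c : Fin N → Bool => 2 * ∑ i, if c i then (1 : ℝ) else 0) := by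
        refine wExp_mono (bern_nonneg h0 h1) fun c => ?_
        by_cases hc : c = fun _ => false
        · simp [hc]
        · obtain ⟨i, hi⟩ := Function.ne_iff.1 hc
          have hi' : c i = true := by simpa using hi
          have h2 := abs_sub (f c) (f fun _ => false)
          have h3 : (1 : ℝ) ≤ ∑ i, if c i then (1 : ℝ) else 0 := by
            have := single_le_sum (f := fun i => if c i then (1 : ℝ) else 0)
              (fun i _ => by positivity) (mem_univ i)
            simpa [hi'] using this
          linarith [hf c, hf fun _ => false]
    _ = 2 * N * p := by
        rw [wExp_const_mul, wExp_sum]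
        simp only [wExp_apply (sum_bern p) _ (fun b => if b then (1 : ℝ) else 0)]
        simp [bern]
        ring

lemma abs_wExp_bern_sub_true {N : ℕ} {p : ℝ} (h0 : 0 ≤ p) (h1 : p ≤ 1)
    {f : (Fin N → Bool) → ℝ} (hf : ∀ c, |f c| ≤ 1) :
    |wExp (bern p) f - f (fun _ => true)| ≤ 2 * N * (1 - p) := by
  rw [← wExp_const (ι := Fin N) (sum_bern p) (f fun _ => true), ← wExp_sub]
  refine (abs_wExp_le (bern_nonneg h0 h1) _).trans ?_
  calc _ ≤ wExp (bern p) (fun c : Fin N → Bool => 2 * ∑ i, if c i then (0 : ℝ) else 1) := by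
        refine wExp_mono (bern_nonneg h0 h1) fun c => ?_
        by_cases hc : c = fun _ => true
        · simp [hc]
        · obtain ⟨i, hi⟩ := Function.ne_iff.1 hc
          have hi' : c i = false := by simpa using hi
          have h2 := abs_sub (f c) (f fun _ => true)
          have h3 : (1 : ℝ) ≤ ∑ i, if c i then (0 : ℝ) else 1 := by
            have := single_le_sum (f := fun i => if c i then (0 : ℝ) else 1)
              (fun i _ => by positivity) (mem_univ i)
            simpa [hi'] using this
          linarith [hf c, hf fun _ => true]
    _ = 2 * N * (1 - p) := by
        rw [wExp_const_mul, wExp_sum]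
        simp only [wExp_apply (sum_bern p) _ (fun b => if b then (0 : ℝ) else 1)]
        simp [bern]
        ring

lemma sum_bern_mul_trigScore (θ : ℝ) :
    ∑ b, bern (Real.sin θ ^ 2) b * trigScore θ b = 0 := by
  simp [bern, trigScore, ← Real.cos_sq']
  field_simp
  ring

/-- The two terms are `4 cos² θ` and `4 sin² θ`: in the angle, a Bernoulli variable has constant
Fisher information, so even extreme biases do not inflate the variance of the score. -/
lemma sum_bern_mul_trigScore_sq {θ : ℝ} (hs : Real.sin θ ≠ 0) (hc : Real.cos θ ≠ 0) :
    ∑ b, bern (Real.sin θ ^ 2) b * trigScore θ b ^ 2 = 4 := by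
  simp [bern, trigScore, ← Real.cos_sq']
  field_simp
  have := Real.sin_sq_add_cos_sq θ
  linear_combination 4 * this

lemma abs_trigScore_le {θ θ₀ : ℝ} (h0 : 0 < θ₀) (h1 : θ₀ ≤ θ) (h2 : θ ≤ Real.pi / 2 - θ₀)
    (b : Bool) : |trigScore θ b| ≤ 2 / θ₀ := by
  have key : ∀ t : ℝ, θ₀ ≤ t → t < Real.pi / 2 → |2 * (Real.cos t / Real.sin t)| ≤ 2 / θ₀ := by
    intro t ht ht'
    have htan := Real.lt_tan (h0.trans_le ht) ht'
    have hpos : 0 < Real.tan t := by linarith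
    rw [← inv_div, ← Real.tan_eq_sin_div_cos, abs_of_pos (by positivity), ← div_eq_mul_inv]
    gcongr
    linarith
  cases b
  · have := key (Real.pi / 2 - θ) (by linarith) (by linarith)
    rw [Real.cos_pi_div_two_sub, Real.sin_pi_div_two_sub] at this
    simpa [trigScore] using this
  · simpa [trigScore] using key θ h1 (by linarith)

/-- The noisy angles form a uniform grid of `[θ₀, π/2 - θ₀]`, a discrete arcsine law for the bias,
and each constant bit has weight `(1 - ν) / 2`. The correlation with `f` is `ν / L` times a Riemann
sum of `G'`, where `G θ` is the mean of `f` at bias `sin² θ` and `L` is the length of the interval.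
The error consists of `η` from the grid and `2 * N * θ₀ ^ 2` at each end, where `G` is compared with
a constant pattern. The factor `lam` solves `lam * (1 - ν) / 2 = ν / L`. -/
lemma exists_code (N : ℕ) {ν θ₀ η : ℝ} (hν0 : 0 ≤ ν) (hν1 : ν < 1) (hθ0 : 0 < θ₀)
    (hθ1 : θ₀ < Real.pi / 4) (hη : 0 < η) :
    Nonempty (Code N ν (2 * ν / ((Real.pi / 2 - 2 * θ₀) * (1 - ν)))
      (ν / (Real.pi / 2 - 2 * θ₀) * (4 * N * θ₀ ^ 2 + η)) (2 / θ₀)) := by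
  have hab : θ₀ < Real.pi / 2 - θ₀ := by linarith
  choose K₀ hK₀ using fun c : Fin N → Bool =>
    exists_riemann_sum_near (contDiff_prod_bern c) hab (ε := η / 2 ^ N) (by positivity)
  -- One grid serves all `2 ^ N` bit patterns, each with error `η / 2 ^ N`.
  set K := univ.sup K₀ + 1 with hK
  have hKpos : (0 : ℝ) < K := by positivity
  set L := Real.pi / 2 - 2 * θ₀ with hL
  have hLpos : 0 < L := by rw [hL]; linarith
  have hLab : Real.pi / 2 - θ₀ - θ₀ = L := by rw [hL]; ring
  have hriemann : ∀ c : Fin N → Bool, _ := fun c =>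
    hK₀ c K ((le_sup (mem_univ c)).trans (Nat.le_succ _)) (by omega)
  simp only [hLab] at hriemann
  set θ : Fin K → ℝ := fun k => θ₀ + k * (L / K) with hθ
  have hθl : ∀ k, θ₀ ≤ θ k := fun k => by
    have : 0 ≤ k * (L / K) := by positivity
    rw [hθ]; linarith
  have hθu : ∀ k, θ k ≤ Real.pi / 2 - θ₀ := fun k => by
    have hk : (k : ℝ) ≤ K := by exact_mod_cast k.2.le
    have : k * (L / K) ≤ L := by
      rw [mul_div_assoc', div_le_iff₀ hKpos, mul_comm L]; gcongr
    simp only [hθ]; linarith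
  have hsin : ∀ k, 0 < Real.sin (θ k) := fun k =>
    Real.sin_pos_of_pos_of_lt_pi (by linarith [hθl k]) (by linarith [hθu k, Real.pi_pos])
  have hcos : ∀ k, 0 < Real.cos (θ k) := fun k =>
    Real.cos_pos_of_mem_Ioo ⟨by linarith [hθl k, Real.pi_pos], by linarith [hθu k]⟩
  refine ⟨{
    K := K
    wt := Sum.elim (fun _ => (1 - ν) / 2) (fun _ => ν / K)
    bias := Sum.elim (fun b => if b then 1 else 0) (fun k => Real.sin (θ k) ^ 2)
    score := Sum.elim (fun _ _ => 0) (fun k => trigScore (θ k))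
    wt_nonneg := ?_
    wt_sum := ?_
    wt_noisy := ?_
    bias_nonneg := ?_
    bias_le_one := ?_
    bias_const := fun _ => rfl
    score_const := fun _ _ => rfl
    score_mean := ?_
    score_sq := ?_
    abs_score_le := ?_
    correlation := ?_ }⟩
  · rintro (b | k)
    · simp only [Sum.elim_inl]; linarith
    · simp only [Sum.elim_inr]; positivity
  · simp only [Fintype.sum_sum_type, Sum.elim_inl, Sum.elim_inr, sum_const, card_univ,
      Fintype.card_bool, Fintype.card_fin, nsmul_eq_mul]
    field_simp
    push_cast
    ring
  · simp only [Sum.elim_inr, sum_const, card_univ, Fintype.card_fin, nsmul_eq_mul]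
    field_simp
  · rintro (b | k)
    · cases b <;> simp
    · simp only [Sum.elim_inr]; positivity
  · rintro (b | k)
    · cases b <;> simp
    · simpa using Real.abs_sin_le_one (θ k)
  · rintro (b | k)
    · simp
    · exact sum_bern_mul_trigScore _
  · rintro (b | k)
    · simp
    · exact (sum_bern_mul_trigScore_sq (hsin k).ne' (hcos k).ne').le
  · rintro (b | k) c
    · simp only [Sum.elim_inl, abs_zero]; positivity
    · exact abs_trigScore_le hθ0 (hθl k) (hθu k) c
  · intro f hf
    set G : ℝ → ℝ := fun t => wExp (bern (Real.sin t ^ 2)) f with hG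
    have hnoisy : ∑ k, ν / K * wExp (bern (Real.sin (θ k) ^ 2))
        (fun c => f c * ∑ i, trigScore (θ k) (c i)) =
        ν / L * ∑ c, f c * (L / K * ∑ k,
          deriv (fun t => ∏ i, bern (Real.sin t ^ 2) (c i)) (θ k)) := by
      simp only [wExp, mul_sum]
      rw [sum_comm]
      refine sum_congr rfl fun c _ => sum_congr rfl fun k _ => ?_
      rw [(hasDerivAt_prod_bern (hcos k).ne' c).deriv]
      field_simp
      rw [mul_sum, mul_sum]
      exact sum_congr rfl fun i _ => by field_simp
    have hGdiff : |∑ c, f c * (L / K * ∑ k,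
          deriv (fun t => ∏ i, bern (Real.sin t ^ 2) (c i)) (θ k)) -
        (G (Real.pi / 2 - θ₀) - G θ₀)| ≤ η := by
      simp only [hG, wExp, ← sum_sub_distrib]
      refine (abs_sum_le_sum_abs _ _).trans ?_
      calc _ ≤ ∑ _c : Fin N → Bool, η / 2 ^ N := by
            refine sum_le_sum fun c _ => ?_
            calc _ = |f c| * |L / K * ∑ k,
                deriv (fun t => ∏ i, bern (Real.sin t ^ 2) (c i)) (θ k) -
                (∏ i, bern (Real.sin (Real.pi / 2 - θ₀) ^ 2) (c i) -
                  ∏ i, bern (Real.sin θ₀ ^ 2) (c i))| := by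
                  rw [← abs_mul]; congr 1; ring
              _ ≤ 1 * (η / 2 ^ N) :=
                  mul_le_mul (hf c) (hriemann c) (abs_nonneg _) zero_le_one
              _ = _ := one_mul _
        _ = η := by simp [card_univ]; field_simp
    have hs2 : Real.sin θ₀ ^ 2 ≤ θ₀ ^ 2 := by
      have := Real.sin_le hθ0.le
      have := Real.sin_nonneg_of_nonneg_of_le_pi hθ0.le (by linarith [Real.pi_pos])
      gcongr
    have hs1 : Real.sin θ₀ ^ 2 ≤ 1 := Real.sin_sq_le_one _
    have hend0 : |G θ₀ - f (fun _ => false)| ≤ 2 * N * θ₀ ^ 2 :=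
      (abs_wExp_bern_sub_false (sq_nonneg _) hs1 hf).trans (by gcongr)
    have hend1 : |G (Real.pi / 2 - θ₀) - f (fun _ => true)| ≤ 2 * N * θ₀ ^ 2 := by
      refine (abs_wExp_bern_sub_true (sq_nonneg _) (Real.sin_sq_le_one _) hf).trans ?_
      rw [← Real.cos_sq', Real.cos_pi_div_two_sub]
      gcongr
    simp only [Fintype.sum_sum_type, Sum.elim_inl, Sum.elim_inr, sum_const_zero, mul_zero, hnoisy]
    have hz : ∀ p, wExp (bern p) (fun _ : Fin N → Bool => (0 : ℝ)) = 0 := by simp [wExp]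
    simp only [hz, mul_zero, sum_const_zero, zero_add]
    have hν : 0 < 1 - ν := by linarith
    set R := ∑ c, f c * (L / K * ∑ k, deriv (fun t => ∏ i, bern (Real.sin t ^ 2) (c i)) (θ k))
    have hrw : ν / L * R - 2 * ν / (L * (1 - ν)) *
        ((1 - ν) / 2 * f (fun _ => true) - (1 - ν) / 2 * f (fun _ => false)) =
        ν / L * (R - (f (fun _ => true) - f (fun _ => false))) := by
      field_simp
    rw [hrw, abs_mul, abs_of_nonneg (by positivity)]
    gcongr
    rw [abs_le] at *
    constructor <;> linarith

/-! ### Score processes driven by causal signs -/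

namespace Code

variable {N : ℕ} {ν lam err B : ℝ} (C : Code N ν lam err B)

/-- The coins of one round: its kind and the bits of the users. -/
abbrev Round : Type := (Bool ⊕ Fin C.K) × (Fin N → Bool)

/-- The distribution of the coins of one round. -/
def roundWt (y : C.Round) : ℝ := C.wt y.1 * ∏ i, bern (C.bias y.1) (y.2 i)

lemma noisy_nonneg {N : ℕ} {ν lam err B : ℝ} (C : Code N ν lam err B) : 0 ≤ ν :=
  C.wt_noisy ▸ sum_nonneg fun _ _ => C.wt_nonneg _

lemma bern_bias_nonneg (τ : Bool ⊕ Fin C.K) (b : Bool) : 0 ≤ bern (C.bias τ) b :=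
  bern_nonneg (C.bias_nonneg τ) (C.bias_le_one τ) b

lemma roundWt_nonneg (y : C.Round) : 0 ≤ C.roundWt y :=
  mul_nonneg (C.wt_nonneg _) (prod_nonneg fun _ _ => C.bern_bias_nonneg _ _)

lemma sum_roundWt_mul (F : C.Round → ℝ) :
    ∑ y, C.roundWt y * F y =
      ∑ τ, C.wt τ * wExp (bern (C.bias τ)) (fun c => F (τ, c)) := by
  rw [Fintype.sum_prod_type]
  refine sum_congr rfl fun τ _ => ?_
  simp only [wExp, mul_sum, roundWt]
  exact sum_congr rfl fun c _ => by ring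

lemma sum_roundWt : ∑ y, C.roundWt y = 1 := by
  have := C.sum_roundWt_mul (fun _ => 1)
  simpa [wExp_one (sum_bern _), C.wt_sum] using this

/-- In a constant round of positive weight, all users get the same bit. -/
lemma bit_eq_of_roundWt_ne_zero {b : Bool} {c : Fin N → Bool}
    (h : C.roundWt (.inl b, c) ≠ 0) (i : Fin N) : c i = b := by
  have h1 := (prod_ne_zero_iff.1 (right_ne_zero_of_mul h)) i (mem_univ i)
  by_contra hne
  refine h1 ?_
  simp only [C.bias_const, Bool.eq_not_of_ne hne]
  cases b <;> simp [bern]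

/-- A statistic blind to the bit of user `i` is uncorrelated with the score of that bit, which has
mean zero. This covers users outside `S` and frozen users alike. -/
lemma wExp_mul_score_eq_zero (τ : Bool ⊕ Fin C.K) {f : (Fin N → Bool) → ℝ} {i : Fin N}
    (hf : ∀ c b, f (update c i b) = f c) :
    wExp (bern (C.bias τ)) (fun c => f c * C.score τ (c i)) = 0 := by
  refine wExp_eq_zero_of_resample (sum_bern _) i fun c => ?_
  calc _ = f c * ∑ b, bern (C.bias τ) b * C.score τ b := by
        rw [mul_sum]
        refine sum_congr rfl fun b _ => ?_
        rw [hf, update_self]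
        ring
    _ = 0 := by rw [C.score_mean, mul_zero]

lemma sum_wt_mul_score_sq_le :
    ∑ τ, C.wt τ * ∑ b, bern (C.bias τ) b * C.score τ b ^ 2 ≤ 4 * ν := by
  have hnoisy : 4 * ν = ∑ k, C.wt (.inr k) * 4 := by rw [← sum_mul, C.wt_noisy, mul_comm]
  rw [Fintype.sum_sum_type, hnoisy]
  simp only [C.score_const, ne_eq, OfNat.ofNat_ne_zero, not_false_eq_true, zero_pow, mul_zero, sum_const_zero,
    zero_add]
  refine sum_le_sum fun k _ => ?_
  exact mul_le_mul_of_nonneg_left (C.score_sq _) (C.wt_nonneg _)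

lemma sum_roundWt_mul_score_sq_le (i : Fin N) :
    ∑ y : C.Round, C.roundWt y * C.score y.1 (y.2 i) ^ 2 ≤ 4 * ν := by
  rw [C.sum_roundWt_mul]
  refine le_trans (le_of_eq (sum_congr rfl fun τ _ => ?_)) C.sum_wt_mul_score_sq_le
  rw [wExp_apply (sum_bern _) i (fun b => C.score τ b ^ 2)]

/-- Given the kind of the round, the scores of distinct users are independent and centred, so the
cross terms vanish. -/
lemma sum_roundWt_mul_sq_sum_le (U : Finset (Fin N)) (v : Fin N → ℝ) :
    ∑ y : C.Round, C.roundWt y * (∑ i ∈ U, v i * C.score y.1 (y.2 i)) ^ 2 ≤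
      4 * ν * ∑ i ∈ U, v i ^ 2 := by
  have hdiag : ∀ y : C.Round, C.roundWt y * (∑ i ∈ U, v i * C.score y.1 (y.2 i)) ^ 2 =
      ∑ i ∈ U, ∑ i' ∈ U, v i * v i' *
        (C.roundWt y * (C.score y.1 (y.2 i') * C.score y.1 (y.2 i))) := by
    intro y
    rw [sq, sum_mul_sum, mul_sum]
    refine sum_congr rfl fun i _ => ?_
    rw [mul_sum]
    exact sum_congr rfl fun i' _ => by ring
  rw [sum_congr rfl fun y _ => hdiag y, sum_comm, mul_sum]
  refine sum_le_sum fun i hi => ?_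
  rw [sum_comm, sum_eq_single_of_mem i hi]
  · rw [← mul_sum]
    simp only [← sq]
    rw [mul_comm]
    exact mul_le_mul_of_nonneg_right (C.sum_roundWt_mul_score_sq_le i) (sq_nonneg _)
  · intro i' _ hne
    rw [← mul_sum, C.sum_roundWt_mul, sum_eq_zero, mul_zero]
    intro τ _
    rw [C.wExp_mul_score_eq_zero τ (f := fun c => C.score τ (c i')), mul_zero]
    intro c b
    rw [update_of_ne hne]

/-- The accumulated scores after `j` rounds, when `s` is the sequence of the signs of the answers.
Rounds before `r` do not count, and the score of a user is frozen once it exceeds `σ`. -/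
noncomputable def total (σ : ℝ) (r : ℕ) {ℓ : ℕ} (x : Fin ℓ → C.Round) (s : ℕ → ℝ) :
    ℕ → Fin N → ℝ
  | 0, _ => 0
  | j + 1, i => total σ r x s j i +
      if h : j < ℓ then
        if r ≤ j ∧ total σ r x s j i ≤ σ then s j * C.score (x ⟨j, h⟩).1 ((x ⟨j, h⟩).2 i) else 0
      else 0

lemma total_congr {σ : ℝ} {r ℓ : ℕ} {x x' : Fin ℓ → C.Round} {s s' : ℕ → ℝ} {j : ℕ}
    (hx : ∀ k : Fin ℓ, (k : ℕ) < j → x k = x' k) (hs : ∀ k < j, k < ℓ → s k = s' k) :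
    C.total σ r x s j = C.total σ r x' s' j := by
  induction j with
  | zero => rfl
  | succ j ih =>
    have ih' := ih (fun k hk => hx k (hk.trans j.lt_succ_self))
      (fun k hk => hs k (hk.trans j.lt_succ_self))
    funext i
    simp only [total, ih']
    by_cases h : j < ℓ
    · simp only [h, dif_pos, hx ⟨j, h⟩ j.lt_succ_self, hs j j.lt_succ_self h]
    · simp [h]

/-- A score above `σ` never moves again, so a user who is active at the end was active in every
round. -/
lemma total_le_of_le {σ : ℝ} {r ℓ : ℕ} {x : Fin ℓ → C.Round} {s : ℕ → ℝ} {i : Fin N}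
    {j m : ℕ} (hjm : j ≤ m) (h : C.total σ r x s m i ≤ σ) : C.total σ r x s j i ≤ σ := by
  induction m, hjm using Nat.le_induction with
  | base => exact h
  | succ m _ ih =>
    refine ih ?_
    by_contra hm
    simp only [total, hm, and_false, if_false, dite_eq_ite, ite_self, add_zero] at h

/-- Signs of answers that are given by a party who, in round `j`, knows the earlier rounds and the
current bits of the users of `S` whose score does not exceed `σ`. -/
structure Causal (σ : ℝ) (r : ℕ) {ℓ : ℕ} (S : Finset (Fin N))
    (sgn : (Fin ℓ → C.Round) → ℕ → ℝ) : Prop where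
  sq_eq_one : ∀ x j, sgn x j ^ 2 = 1
  congr : ∀ (x x' : Fin ℓ → C.Round) (j : Fin ℓ), (∀ k < j, x k = x' k) →
    (∀ i ∈ S, C.total σ r x (sgn x) j i ≤ σ → (x j).2 i = (x' j).2 i) → sgn x j = sgn x' j

/-- The contribution of round `j` to the score of user `i`. -/
noncomputable def inc (σ : ℝ) (r : ℕ) {ℓ : ℕ} (sgn : (Fin ℓ → C.Round) → ℕ → ℝ)
    (x : Fin ℓ → C.Round) (j : Fin ℓ) (i : Fin N) : ℝ :=
  if r ≤ j ∧ C.total σ r x (sgn x) j i ≤ σ then sgn x j * C.score (x j).1 ((x j).2 i) else 0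

section ScoreProcess

variable {C} {σ : ℝ} {r ℓ : ℕ} {S : Finset (Fin N)} {sgn : (Fin ℓ → C.Round) → ℕ → ℝ}

lemma total_succ (x : Fin ℓ → C.Round) (j : Fin ℓ) (i : Fin N) :
    C.total σ r x (sgn x) (j + 1) i =
      C.total σ r x (sgn x) j i + C.inc σ r sgn x j i := by
  simp [total, inc]

lemma total_eq_sum (x : Fin ℓ → C.Round) (i : Fin N) {j : ℕ} (hj : j ≤ ℓ) :
    C.total σ r x (sgn x) j i = ∑ k ∈ univ.filter fun k : Fin ℓ => (k : ℕ) < j, C.inc σ r sgn x k i := by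
  induction j with
  | zero => simp [total]
  | succ j ih =>
    have hset : (univ.filter fun k : Fin ℓ => (k : ℕ) < j + 1) =
        insert ⟨j, hj⟩ (univ.filter fun k : Fin ℓ => (k : ℕ) < j) := by
      ext k
      simp only [mem_filter, mem_univ, true_and, mem_insert, Fin.ext_iff]
      omega
    rw [hset, sum_insert (by simp), ← ih (by omega), add_comm (C.inc _ _ _ _ _ _)]
    exact total_succ x ⟨j, hj⟩ i

lemma total_last (x : Fin ℓ → C.Round) (i : Fin N) :
    C.total σ r x (sgn x) ℓ i = ∑ k, C.inc σ r sgn x k i := by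
  rw [total_eq_sum x i le_rfl]
  simp

lemma Causal.sgn_congr (hsgn : C.Causal σ r S sgn) {x x' : Fin ℓ → C.Round} {j : Fin ℓ} (h : ∀ k ≤ j, x k = x' k) :
    sgn x j = sgn x' j :=
  hsgn.congr x x' j (fun k hk => h k hk.le) fun i _ _ => by rw [h j le_rfl]

/-- The score after `k` rounds involves rounds before `k` only, so `k = j` is allowed: who is active
in round `j` is decided before its bits are drawn. -/
lemma Causal.total_update (hsgn : C.Causal σ r S sgn) (x : Fin ℓ → C.Round) (j : Fin ℓ) (y : C.Round) {k : ℕ} (hk : k ≤ j) :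
    C.total σ r (update x j y) (sgn (update x j y)) k = C.total σ r x (sgn x) k := by
  have hx : ∀ m : Fin ℓ, (m : ℕ) < k → update x j y m = x m := fun m hm => by
    rw [update_of_ne]
    rintro rfl
    omega
  refine C.total_congr hx fun m hm hmℓ => ?_
  refine hsgn.sgn_congr (j := ⟨m, hmℓ⟩) fun m' hm' => hx m' ?_
  have : (m' : ℕ) ≤ m := hm'
  omega

lemma Causal.sgn_update_of_lt (hsgn : C.Causal σ r S sgn) (x : Fin ℓ → C.Round) {k j : Fin ℓ} (y : C.Round) (hk : k < j) :
    sgn (update x j y) k = sgn x k :=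
  hsgn.sgn_congr fun m hm => by rw [update_of_ne (hm.trans_lt hk).ne]

lemma Causal.inc_update_of_lt (hsgn : C.Causal σ r S sgn) (x : Fin ℓ → C.Round) {k j : Fin ℓ} (y : C.Round) (hk : k < j) :
    C.inc σ r sgn (update x j y) k = C.inc σ r sgn x k := by
  funext i
  simp only [inc, hsgn.total_update x j y (k := k) (by exact_mod_cast hk.le),
    hsgn.sgn_update_of_lt x y hk, update_of_ne hk.ne]

/-- In round `j` the sign is a function of the bits of the round only. -/
lemma Causal.sgn_update (hsgn : C.Causal σ r S sgn) (x : Fin ℓ → C.Round) (j : Fin ℓ) (y : C.Round) :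
    sgn (update x j y) j = sgn (update x j (.inl true, y.2)) j := by
  refine hsgn.congr _ _ j (fun k hk => ?_) fun i _ _ => ?_
  · rw [update_of_ne hk.ne, update_of_ne hk.ne]
  · simp

/-- The current bit of a user who is outside `S` or already frozen never reaches the sign. -/
lemma Causal.sgn_update_bit (hsgn : C.Causal σ r S sgn) (x : Fin ℓ → C.Round) (j : Fin ℓ) {i : Fin N}
    (hi : ¬(i ∈ S ∧ C.total σ r x (sgn x) j i ≤ σ)) (c : Fin N → Bool) (b : Bool) :
    sgn (update x j (.inl true, update c i b)) j = sgn (update x j (.inl true, c)) j := by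
  refine hsgn.congr _ _ j (fun k hk => ?_) fun i' hi' htot => ?_
  · rw [update_of_ne hk.ne, update_of_ne hk.ne]
  · rw [hsgn.total_update x j _ le_rfl] at htot
    have hne : i' ≠ i := by
      rintro rfl
      exact hi ⟨hi', htot⟩
    simp [update_of_ne hne]

lemma Causal.inc_update (hsgn : C.Causal σ r S sgn) (x : Fin ℓ → C.Round) (j : Fin ℓ) (y : C.Round) (i : Fin N) :
    C.inc σ r sgn (update x j y) j i =
      if r ≤ j ∧ C.total σ r x (sgn x) j i ≤ σ then
        sgn (update x j (.inl true, y.2)) j * C.score y.1 (y.2 i) else 0 := by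
  simp only [inc, hsgn.total_update x j y le_rfl, update_self, hsgn.sgn_update x j y]

/-- Makes the score of a user outside `S` a martingale. -/
lemma Causal.inc_mean (hsgn : C.Causal σ r S sgn) (x : Fin ℓ → C.Round) (j : Fin ℓ) {i : Fin N} (hi : i ∉ S) :
    ∑ y, C.roundWt y * C.inc σ r sgn (update x j y) j i = 0 := by
  simp only [hsgn.inc_update]
  split_ifs with h
  · rw [C.sum_roundWt_mul]
    refine sum_eq_zero fun τ _ => ?_
    rw [C.wExp_mul_score_eq_zero τ (f := fun c => sgn (update x j (.inl true, c)) j), mul_zero]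
    exact hsgn.sgn_update_bit x j fun h => hi h.1
  · simp

/-- The sign is common to all users and squares to `1`; activity is fixed by the past and is
absorbed into the coefficients `v'`. -/
lemma Causal.sq_sum_inc_le (hsgn : C.Causal σ r S sgn) (x : Fin ℓ → C.Round) (j : Fin ℓ) (U : Finset (Fin N))
    (v : Fin N → ℝ) :
    ∑ y, C.roundWt y * (∑ i ∈ U, v i * C.inc σ r sgn (update x j y) j i) ^ 2 ≤
      4 * ν * ∑ i ∈ U, v i ^ 2 := by
  have hν := C.noisy_nonneg
  let v' : Fin N → ℝ := fun i => if r ≤ j ∧ C.total σ r x (sgn x) j i ≤ σ then v i else 0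
  have hsq : ∀ y, (∑ i ∈ U, v i * C.inc σ r sgn (update x j y) j i) ^ 2 =
      (∑ i ∈ U, v' i * C.score y.1 (y.2 i)) ^ 2 := by
    intro y
    have : ∑ i ∈ U, v i * C.inc σ r sgn (update x j y) j i =
        sgn (update x j (.inl true, y.2)) j * ∑ i ∈ U, v' i * C.score y.1 (y.2 i) := by
      rw [mul_sum]
      refine sum_congr rfl fun i _ => ?_
      rw [hsgn.inc_update]
      simp only [v']
      split_ifs <;> ring
    rw [this, mul_pow, hsgn.sq_eq_one, one_mul]
  simp only [hsq]
  refine (C.sum_roundWt_mul_sq_sum_le U v').trans ?_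
  refine mul_le_mul_of_nonneg_left (sum_le_sum fun i _ => ?_) (by linarith)
  simp only [v']
  split_ifs
  · exact le_rfl
  · simpa using sq_nonneg (v i)

lemma Causal.inc_sq_le (hsgn : C.Causal σ r S sgn) (x : Fin ℓ → C.Round) (j : Fin ℓ) (i : Fin N) :
    C.inc σ r sgn x j i ^ 2 ≤ C.score (x j).1 ((x j).2 i) ^ 2 := by
  unfold inc
  split_ifs
  · rw [mul_pow, hsgn.sq_eq_one, one_mul]
  · rw [zero_pow two_ne_zero]
    positivity

lemma Causal.wExp_total_sq_le (hsgn : C.Causal σ r S sgn) {i : Fin N} (hi : i ∉ S) {j : ℕ} (hj : j ≤ ℓ) :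
    wExp C.roundWt (fun x => C.total σ r x (sgn x) j i ^ 2) ≤ 4 * ν * ℓ := by
  have hν := C.noisy_nonneg
  simp only [total_eq_sum _ i hj]
  rw [wExp_sq_sum C.sum_roundWt (fun k x => C.inc σ r sgn x k i)
    (fun k m hkm x y => by rw [hsgn.inc_update_of_lt x y hkm])
    (fun k x => hsgn.inc_mean x k hi)]
  calc _ ≤ ∑ k ∈ univ.filter fun k : Fin ℓ => (k : ℕ) < j, 4 * ν := by
        refine sum_le_sum fun k _ => ?_
        rw [← wExp_const (ι := Fin ℓ) C.sum_roundWt (4 * ν)]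
        refine wExp_le_of_resample C.roundWt_nonneg C.sum_roundWt k fun x => ?_
        simpa using hsgn.sq_sum_inc_le x k {i} (fun _ => 1)
    _ ≤ ∑ k : Fin ℓ, 4 * ν := by
        refine sum_le_sum_of_subset_of_nonneg (filter_subset _ _) fun _ _ _ => by positivity
    _ = 4 * ν * ℓ := by simp; ring

/-! ### Scores of the users outside the sample -/

/-- The sum of the squares of the scores of the users outside `S` is concentrated. -/
lemma Causal.wProb_sum_total_sq_le (hsgn : C.Causal σ r S sgn) (hν : 0 < ν) (hN : 0 < N) (hℓ : 0 < ℓ) {t : ℝ} (ht : 0 < t) :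
    wProb C.roundWt (fun x => t + 8 * ν * N * ℓ ≤ ∑ i ∈ Sᶜ, C.total σ r x (sgn x) ℓ i ^ 2) ≤
      64 * (Sᶜ.card : ℝ) * (ν * ℓ) ^ 2 / t ^ 2 + B ^ 2 / (4 * ν * ℓ) := by
  -- Telescoping the squares gives `2 * total * inc + inc ^ 2` per round. The first part, `A`, is a
  -- martingale difference; the second is dominated by `q`, which depends on the round alone and is
  -- thus independent between rounds.
  let A : Fin ℓ → (Fin ℓ → C.Round) → ℝ := fun j x =>
    ∑ i ∈ Sᶜ, 2 * C.total σ r x (sgn x) j i * C.inc σ r sgn x j i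
  let q : C.Round → ℝ := fun y => ∑ i, C.score y.1 (y.2 i) ^ 2
  have hsum : ∀ x, ∑ i ∈ Sᶜ, C.total σ r x (sgn x) ℓ i ^ 2 ≤ ∑ j, A j x + ∑ j, q (x j) := by
    intro x
    have htel : ∀ i, C.total σ r x (sgn x) ℓ i ^ 2 = ∑ j : Fin ℓ,
        (2 * C.total σ r x (sgn x) j i * C.inc σ r sgn x j i + C.inc σ r sgn x j i ^ 2) := by
      intro i
      have h1 : ∀ j : Fin ℓ,
          2 * C.total σ r x (sgn x) j i * C.inc σ r sgn x j i + C.inc σ r sgn x j i ^ 2 =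
          C.total σ r x (sgn x) ((j : ℕ) + 1) i ^ 2 - C.total σ r x (sgn x) (j : ℕ) i ^ 2 := by
        intro j
        rw [total_succ]
        ring
      rw [sum_congr rfl fun j _ => h1 j, Fin.sum_univ_eq_sum_range
        (fun j => C.total σ r x (sgn x) (j + 1) i ^ 2 - C.total σ r x (sgn x) j i ^ 2),
        sum_range_sub (fun j => C.total σ r x (sgn x) j i ^ 2)]
      simp [total]
    rw [sum_congr rfl fun i _ => htel i, sum_comm, ← sum_add_distrib]
    refine sum_le_sum fun j _ => ?_
    rw [sum_add_distrib]
    refine add_le_add le_rfl ?_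
    calc _ ≤ ∑ i ∈ Sᶜ, C.score (x j).1 ((x j).2 i) ^ 2 :=
          sum_le_sum fun i _ => hsgn.inc_sq_le x j i
      _ ≤ _ := sum_le_sum_of_subset_of_nonneg (subset_univ _) fun _ _ _ => sq_nonneg _
  have hqmean : ∑ y, C.roundWt y * q y ≤ 4 * ν * N := by
    simp only [q, mul_sum]
    rw [sum_comm]
    refine (sum_le_sum fun i _ => C.sum_roundWt_mul_score_sq_le i).trans_eq ?_
    simp
    ring
  have hq0 : ∀ y, 0 ≤ q y := fun y => sum_nonneg fun _ _ => sq_nonneg _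
  have hqB : ∀ y, q y ≤ N * B ^ 2 := by
    intro y
    calc q y ≤ ∑ _i : Fin N, B ^ 2 := sum_le_sum fun i _ => by
          rw [← sq_abs]
          have := C.abs_score_le y.1 (y.2 i)
          gcongr
      _ = _ := by simp
  have hAmean : ∀ j x, ∑ y, C.roundWt y * A j (update x j y) = 0 := by
    intro j x
    simp only [A, hsgn.total_update x j _ le_rfl, mul_sum]
    rw [sum_comm]
    refine sum_eq_zero fun i hi => ?_
    have := hsgn.inc_mean x j (mem_compl.1 hi)
    calc _ = 2 * C.total σ r x (sgn x) j i *
          ∑ y, C.roundWt y * C.inc σ r sgn (update x j y) j i := by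
          rw [mul_sum]; exact sum_congr rfl fun y _ => by ring
      _ = 0 := by rw [this, mul_zero]
  -- The conditional second moment of `A j` is at most `16 * ν` times the current sum of squares,
  -- whose mean is at most `4 * ν * ℓ` per user.
  have hA := wProb_sum_sub_mean_le C.roundWt_nonneg C.sum_roundWt A (fun k j hkj x y => by
      simp only [A, hsgn.total_update x j y (k := k) (by exact_mod_cast hkj.le),
        hsgn.inc_update_of_lt x y hkj]) (v := 64 * (Sᶜ.card : ℝ) * ν ^ 2 * ℓ) ht (by
    intro j
    calc _ ≤ wExp C.roundWt (fun x => 16 * ν * ∑ i ∈ Sᶜ, C.total σ r x (sgn x) j i ^ 2) := by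
          refine wExp_le_of_resample C.roundWt_nonneg C.sum_roundWt j fun x => ?_
          simp only [A, hsgn.total_update x j _ le_rfl]
          refine (hsgn.sq_sum_inc_le x j Sᶜ _).trans_eq ?_
          simp only [mul_sum]
          exact sum_congr rfl fun i _ => by ring
      _ ≤ 16 * ν * ∑ i ∈ Sᶜ, 4 * ν * ℓ := by
          rw [wExp_const_mul, wExp_sum]
          gcongr with i hi
          exact hsgn.wExp_total_sq_le (mem_compl.1 hi) j.2.le
      _ = _ := by simp; ring)
  -- The sum of `q` has mean at most `4 * ν * N * ℓ`, and the same amount is allowed for its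
  -- deviation: hence the `8` in the statement.
  have hQ := wProb_sum_sub_mean_le C.roundWt_nonneg C.sum_roundWt
    (fun j (x : Fin ℓ → C.Round) => q (x j)) (fun k j hkj x y => by rw [update_of_ne hkj.ne])
    (v := N * B ^ 2 * (4 * ν * N)) (t := 4 * ν * N * ℓ) (by positivity) (by
    intro j
    rw [wExp_apply C.sum_roundWt j (fun y => q y ^ 2)]
    calc _ ≤ ∑ y, N * B ^ 2 * (C.roundWt y * q y) := by
          refine sum_le_sum fun y _ => ?_
          have := mul_le_mul_of_nonneg_left (hqB y) (mul_nonneg (C.roundWt_nonneg y) (hq0 y))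
          calc _ = C.roundWt y * q y * q y := by ring
            _ ≤ _ := this
            _ = _ := by ring
      _ ≤ _ := by
          rw [← mul_sum]
          gcongr)
  refine (wProb_mono C.roundWt_nonneg fun x hx => ?_).trans
    ((wProb_or_le C.roundWt_nonneg _ _).trans ((add_le_add hA hQ).trans_eq ?_))
  · by_contra hcon
    rw [not_or, not_le, not_le] at hcon
    simp only [hAmean, sub_zero, update_self, sum_sub_distrib, sum_const, card_univ,
      Fintype.card_fin, nsmul_eq_mul] at hcon
    have h1 := (le_abs_self _).trans_lt hcon.1
    have h2 := (le_abs_self _).trans_lt hcon.2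
    have h3 : (ℓ : ℝ) * ∑ y, C.roundWt y * q y ≤ ℓ * (4 * ν * N) := by gcongr
    linarith [hsum x]
  · simp only [Fintype.card_fin]
    have : (ℓ : ℝ) ≠ 0 := by positivity
    congr 1
    · ring
    · field_simp

/-! ### Scores of the sample against the signs in constant rounds -/

/-- `1` or `-1` in a constant round, according to whether the sign agrees with its bit, and `1` in a
noisy round. -/
def align {K : ℕ} (τ : Bool ⊕ Fin K) (s : ℝ) : ℝ :=
  match τ with
  | .inl true => s
  | .inl false => -s
  | .inr _ => 1

lemma align_sq {K : ℕ} (τ : Bool ⊕ Fin K) {s : ℝ} (hs : s ^ 2 = 1) : align τ s ^ 2 = 1 := by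
  rcases τ with (_ | _) | _ <;> simp [align, hs]

/-- The scores gained in round `j` by the users of `S`, compared with the alignment of the sign. -/
noncomputable def gain (C : Code N ν lam err B) (σ : ℝ) (r : ℕ) {ℓ : ℕ} (S : Finset (Fin N))
    (sgn : (Fin ℓ → C.Round) → ℕ → ℝ) (j : Fin ℓ) (x : Fin ℓ → C.Round) : ℝ :=
  if r ≤ j then ∑ i ∈ S, C.inc σ r sgn x j i - lam * (align (x j).1 (sgn x j) - ν) else 0

/-- Given the past, the sign is a function `f` of the current bits. Users outside `S` and frozen
users have zero correlation with `f`, so the gain of the active users of `S` has the same mean as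
the sum over all users, to which `C.correlation` applies. -/
lemma Causal.abs_gain_mean_le (hsgn : C.Causal σ r S sgn) (herr : 0 ≤ err)
    (x : Fin ℓ → C.Round) (j : Fin ℓ) :
    |∑ y, C.roundWt y * C.gain σ r S sgn j (update x j y)| ≤ err := by
  by_cases hr : r ≤ j
  swap
  · simpa [gain, hr] using herr
  set f : (Fin N → Bool) → ℝ := fun c => sgn (update x j (.inl true, c)) j with hf
  have hf1 : ∀ c, |f c| ≤ 1 := fun c => by
    rw [← sq_le_one_iff_abs_le_one, hf, hsgn.sq_eq_one]
  have hscore : ∀ τ, wExp (bern (C.bias τ)) (fun c => f c * ∑ i, C.score τ (c i)) =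
      wExp (bern (C.bias τ))
        (fun c => ∑ i ∈ S, C.inc σ r sgn (update x j (τ, c)) j i) := by
    intro τ
    simp only [mul_sum, wExp_sum, hsgn.inc_update]
    rw [← sum_subset (subset_univ S)]
    · refine sum_congr rfl fun i hi => ?_
      by_cases hact : C.total σ r x (sgn x) j i ≤ σ
      · simp only [hr, hact, and_self, if_true, hf]
      · rw [C.wExp_mul_score_eq_zero τ (hsgn.sgn_update_bit x j fun h => hact h.2)]
        simp [hact, wExp]
    · intro i _ hi
      exact C.wExp_mul_score_eq_zero τ (hsgn.sgn_update_bit x j fun h => hi h.1)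
  have halign : ∑ y : C.Round, C.roundWt y * align y.1 (f y.2) =
      C.wt (.inl true) * f (fun _ => true) - C.wt (.inl false) * f (fun _ => false) + ν := by
    rw [C.sum_roundWt_mul, Fintype.sum_sum_type]
    simp only [Fintype.sum_bool, align, C.bias_const, if_true, Bool.false_eq_true, if_false,
      wExp_bern_zero, wExp_bern_one, wExp_one (sum_bern _), mul_one, C.wt_noisy]
    ring
  have hmean : ∑ y, C.roundWt y * C.gain σ r S sgn j (update x j y) =
      ∑ τ, C.wt τ * wExp (bern (C.bias τ)) (fun c => f c * ∑ i, C.score τ (c i)) -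
      lam * (C.wt (.inl true) * f (fun _ => true) - C.wt (.inl false) * f (fun _ => false)) := by
    simp only [hscore]
    rw [← C.sum_roundWt_mul (fun y => ∑ i ∈ S, C.inc σ r sgn (update x j y) j i)]
    have h1 : C.wt (.inl true) * f (fun _ => true) - C.wt (.inl false) * f (fun _ => false) =
        ∑ y : C.Round, C.roundWt y * (align y.1 (f y.2) - ν) := by
      simp only [mul_sub, sum_sub_distrib, halign, ← sum_mul, C.sum_roundWt]
      ring
    rw [h1, mul_sum, ← sum_sub_distrib]
    refine sum_congr rfl fun y _ => ?_
    simp only [gain, hr, if_true, update_self, hsgn.sgn_update x j y, hf]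
    ring
  rw [hmean]
  exact C.correlation f hf1

lemma Causal.gain_update_of_lt (hsgn : C.Causal σ r S sgn) (x : Fin ℓ → C.Round) {k j : Fin ℓ}
    (y : C.Round) (hk : k < j) :
    C.gain σ r S sgn k (update x j y) = C.gain σ r S sgn k x := by
  simp only [gain, hsgn.inc_update_of_lt x y hk, hsgn.sgn_update_of_lt x y hk,
    update_of_ne hk.ne]

lemma Causal.wExp_gain_sq_le (hsgn : C.Causal σ r S sgn) (hν : ν ≤ 1) (j : Fin ℓ) :
    wExp C.roundWt (fun x => C.gain σ r S sgn j x ^ 2) ≤ 8 * ν * S.card + 8 * lam ^ 2 := by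
  have hν0 := C.noisy_nonneg
  rw [← wExp_const (ι := Fin ℓ) C.sum_roundWt (8 * ν * S.card + 8 * lam ^ 2)]
  refine wExp_le_of_resample C.roundWt_nonneg C.sum_roundWt j fun x => ?_
  calc _ ≤ ∑ y, C.roundWt y *
        (2 * (∑ i ∈ S, 1 * C.inc σ r sgn (update x j y) j i) ^ 2 + 8 * lam ^ 2) := by
        refine sum_le_sum fun y _ => mul_le_mul_of_nonneg_left ?_ (C.roundWt_nonneg y)
        simp only [one_mul, gain]
        split_ifs
        · have h1 := align_sq (update x j y j).1 (hsgn.sq_eq_one (update x j y) j)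
          set a := align (update x j y j).1 (sgn (update x j y) j)
          set D := ∑ i ∈ S, C.inc σ r sgn (update x j y) j i
          have h2 : (a - ν) ^ 2 ≤ 4 := by
            have := sq_nonneg (a + ν)
            nlinarith
          calc _ ≤ 2 * D ^ 2 + 2 * lam ^ 2 * (a - ν) ^ 2 := by
                nlinarith [sq_nonneg (D + lam * (a - ν))]
            _ ≤ 2 * D ^ 2 + 2 * lam ^ 2 * 4 := by gcongr
            _ = _ := by ring
        · rw [zero_pow two_ne_zero]
          positivity
    _ = 2 * ∑ y, C.roundWt y * (∑ i ∈ S, 1 * C.inc σ r sgn (update x j y) j i) ^ 2 +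
        8 * lam ^ 2 := by
        simp only [mul_add, sum_add_distrib, ← sum_mul, C.sum_roundWt, one_mul, mul_sum]
        congr 1
        exact sum_congr rfl fun y _ => by ring
    _ ≤ 2 * (4 * ν * ∑ i ∈ S, 1 ^ 2) + 8 * lam ^ 2 := by
        gcongr
        exact hsgn.sq_sum_inc_le x j S fun _ => 1
    _ = _ := by simp; ring

/-- The last move before freezing starts at most at `σ` and adds at most `B`. -/
lemma Causal.total_le (hsgn : C.Causal σ r S sgn) (hσ : 0 ≤ σ) (hB : 0 ≤ B)
    (x : Fin ℓ → C.Round) (i : Fin N) {j : ℕ} (hj : j ≤ ℓ) :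
    C.total σ r x (sgn x) j i ≤ σ + B := by
  induction j with
  | zero => simp only [total]; positivity
  | succ j ih =>
    have h1 := total_succ (σ := σ) (r := r) (sgn := sgn) x ⟨j, hj⟩ i
    simp only at h1
    rw [h1]
    unfold inc
    split_ifs with h
    · refine add_le_add h.2 ((le_abs_self _).trans ?_)
      have h2 : |sgn x j| = 1 := by
        rcases sq_eq_one_iff.1 (hsgn.sq_eq_one x j) with h | h <;> simp [h]
      simp only [abs_mul, h2, one_mul]
      exact C.abs_score_le _ _
    · simpa using ih (by omega)

open Classical in
/-- The number of the counted constant rounds in which the sign disagrees with the bit. -/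
noncomputable def wrongCount (C : Code N ν lam err B) (r : ℕ) {ℓ : ℕ}
    (sgn : (Fin ℓ → C.Round) → ℕ → ℝ) (x : Fin ℓ → C.Round) : ℕ :=
  (univ.filter fun j : Fin ℓ => r ≤ (j : ℕ) ∧ align (x j).1 (sgn x j) = -1).card

/-- The signs cannot agree with the bit in many more than half of the constant rounds. -/
lemma Causal.wProb_wrongCount_le (hsgn : C.Causal σ r S sgn) (hν : ν ≤ 1) (herr : 0 ≤ err)
    (hlam : 0 ≤ lam) (hσ : 0 ≤ σ) (hB : 0 ≤ B) {m t : ℝ} (ht : 0 < t)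
    (h : S.card * (σ + B) + ℓ * err + t ≤ lam * (ℓ - r - 2 * m - ν * ℓ)) :
    wProb C.roundWt (fun x => (C.wrongCount r sgn x : ℝ) ≤ m) ≤
      ℓ * (8 * ν * S.card + 8 * lam ^ 2) / t ^ 2 := by
  classical
  have hcheb := wProb_sum_sub_mean_le C.roundWt_nonneg C.sum_roundWt (C.gain σ r S sgn)
    (fun k j hkj x y => hsgn.gain_update_of_lt x y hkj) ht (hsgn.wExp_gain_sq_le hν)
  rw [Fintype.card_fin] at hcheb
  refine (wProb_mono C.roundWt_nonneg fun x hx => ?_).trans hcheb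
  have hmean : -(ℓ * err) ≤ ∑ j, ∑ y, C.roundWt y * C.gain σ r S sgn j (update x j y) := by
    calc -(ℓ * err) = ∑ _j : Fin ℓ, -err := by simp
      _ ≤ _ := sum_le_sum fun j _ => (abs_le.1 (hsgn.abs_gain_mean_le herr x j)).1
  have hscore : ∑ j, ∑ i ∈ S, C.inc σ r sgn x j i ≤ S.card * (σ + B) := by
    rw [sum_comm, ← nsmul_eq_mul]
    refine sum_le_card_nsmul _ _ _ fun i _ => ?_
    rw [← total_last]
    exact hsgn.total_le hσ hB x i le_rfl
  -- Equality in counted rounds, where the alignment is `1 - 2 * [wrong]`; in an uncounted round the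
  -- right side is `lam * ν`.
  have hgain : ∀ j, C.gain σ r S sgn j x ≤ ∑ i ∈ S, C.inc σ r sgn x j i -
      lam * ((1 - ν) - (if (j : ℕ) < r then 1 else 0) -
        2 * (if r ≤ (j : ℕ) ∧ align (x j).1 (sgn x j) = -1 then 1 else 0)) := by
    intro j
    have hν0 := C.noisy_nonneg
    by_cases hr : r ≤ j
    · have h1 := align_sq (x j).1 (hsgn.sq_eq_one x j)
      rcases sq_eq_one_iff.1 h1 with h1 | h1
      · norm_num [gain, hr, h1, not_lt.2 hr]
      · norm_num [gain, hr, h1, not_lt.2 hr]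
        nlinarith
    · have hr' := not_le.1 hr
      have : ∀ i, C.inc σ r sgn x j i = 0 := fun i => by simp [inc, hr]
      simp [gain, hr, hr', this]
      positivity
  have hcount : ∑ j : Fin ℓ, (if (j : ℕ) < r then (1 : ℝ) else 0) ≤ r := by
    rw [Fin.sum_univ_eq_sum_range (fun j => if j < r then (1 : ℝ) else 0), sum_boole]
    have : ((range ℓ).filter (· < r)).card ≤ (range r).card :=
      card_le_card fun j hj => by simp at hj ⊢; exact hj.2
    simpa using this
  have hwrong : ∑ j : Fin ℓ, (if r ≤ (j : ℕ) ∧ align (x j).1 (sgn x j) = -1 then (1 : ℝ) else 0) =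
      C.wrongCount r sgn x := by
    rw [sum_boole, wrongCount]
  have htotal := sum_le_sum fun j (_ : j ∈ univ) => hgain j
  rw [sum_sub_distrib, ← mul_sum, sum_sub_distrib, sum_sub_distrib, ← mul_sum, hwrong] at htotal
  simp only [sum_const, card_univ, Fintype.card_fin, nsmul_eq_mul] at htotal
  rw [sum_sub_distrib]
  refine le_trans ?_ (neg_le_abs _)
  have : lam * (ℓ - r - 2 * m - ν * ℓ) ≤
      lam * (ℓ * (1 - ν) - ∑ j : Fin ℓ, (if (j : ℕ) < r then (1 : ℝ) else 0) -
        2 * C.wrongCount r sgn x) := by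
    refine mul_le_mul_of_nonneg_left ?_ hlam
    linarith
  linarith

end ScoreProcess

end Code

/-! ### Transcripts of the game and measurability in the coins of the oracle -/

section Transcript

open NonPrivacy

variable {n d ℓ : ℕ} (O : Oracle.{u} d) (A : Adversary n d ℓ)

/-- The query of round `t`. -/
def roundQuery (ω : O.Coins) (η : A.Coins) (x : Finset (Cube d)) (t : ℕ) : Query d :=
  A.ask t η (transcript O A ω η x t).1

/-- The answer in round `t`. -/
def roundAnswer (ω : O.Coins) (η : A.Coins) (x : Finset (Cube d)) (t : ℕ) : Answer :=
  (transcript O A ω η x (t + 1)).1 (Fin.last t)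

lemma transcript_fst (ω : O.Coins) (η : A.Coins) (x : Finset (Cube d)) {j : ℕ} (t : Fin j) :
    (transcript O A ω η x j).1 t = roundAnswer O A ω η x t := by
  induction j with
  | zero => exact t.elim0
  | succ j ih =>
    induction t using Fin.lastCases with
    | last => rfl
    | cast t =>
      simp only [transcript, Fin.snoc_castSucc]
      exact ih t

lemma transcript_snd (ω : O.Coins) (η : A.Coins) (x : Finset (Cube d)) {j : ℕ} (t : Fin j) :
    (transcript O A ω η x j).2 t = roundQuery O A ω η x t := by
  induction j with
  | zero => exact t.elim0
  | succ j ih =>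
    induction t using Fin.lastCases with
    | last => simp [transcript, roundQuery]
    | cast t =>
      simp only [transcript, Fin.snoc_castSucc]
      exact ih t

lemma measurable_snoc {α β : Type*} [MeasurableSpace α] [MeasurableSpace β] {j : ℕ}
    {f : α → Fin j → β} {g : α → β} (hf : Measurable f) (hg : Measurable g) :
    Measurable fun a => (Fin.snoc (f a) (g a) : Fin (j + 1) → β) := by
  refine measurable_pi_iff.2 fun t => ?_
  induction t using Fin.lastCases with
  | last => simpa using hg
  | cast t =>
    simp only [Fin.snoc_castSucc]
    exact (measurable_pi_apply t).comp hf

lemma measurable_transcript (η : A.Coins) (x : Finset (Cube d)) (j : ℕ) :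
    Measurable fun ω => transcript O A ω η x j := by
  induction j with
  | zero => exact measurable_const
  | succ j ih =>
    have hask : Measurable fun ω => A.ask j η (transcript O A ω η x j).1 :=
      (A.measurable_ask j).comp (measurable_const.prodMk (measurable_fst.comp ih))
    have hq := measurable_snoc (measurable_snd.comp ih) hask
    exact (measurable_snoc (measurable_fst.comp ih)
      ((O.measurable_respond j x).comp (measurable_id.prodMk hq))).prodMk hq

lemma measurableSet_accurateRun (α β : ℝ) (η : A.Coins) (S : Finset (Fin (2 * n))) :
    MeasurableSet {ω | AccurateRun O A α β ω η S} := by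
  classical
  have ht := measurable_transcript O A η (sample A η S) ℓ
  have hround : ∀ j : Fin ℓ, MeasurableSet {ω |
      |((transcript O A ω η (sample A η S) ℓ).1 j : ℝ) -
        average ((transcript O A ω η (sample A η S) ℓ).2 j) (sample A η S)| ≤ α} := by
    intro j
    have h1 : Measurable fun ω => ((transcript O A ω η (sample A η S) ℓ).1 j : ℝ) :=
      measurable_subtype_coe.comp ((measurable_pi_apply j).comp (measurable_fst.comp ht))
    have h2 : Measurable fun ω =>
        average ((transcript O A ω η (sample A η S) ℓ).2 j) (sample A η S) := by
      unfold NonPrivacy.average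
      refine Measurable.div_const (Finset.measurable_sum _ fun z _ => ?_) _
      exact measurable_subtype_coe.comp ((measurable_pi_apply z).comp
        ((measurable_pi_apply j).comp (measurable_snd.comp ht)))
    exact measurableSet_le (by simpa using (h1.sub h2).norm) measurable_const
  have hcount : ∀ ω, ({j : Fin ℓ | |((transcript O A ω η (sample A η S) ℓ).1 j : ℝ) -
      average ((transcript O A ω η (sample A η S) ℓ).2 j) (sample A η S)| ≤ α}.ncard : ℝ) =
      ∑ j : Fin ℓ, Set.indicator {ω | |((transcript O A ω η (sample A η S) ℓ).1 j : ℝ) -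
        average ((transcript O A ω η (sample A η S) ℓ).2 j) (sample A η S)| ≤ α}
        (fun _ => (1 : ℝ)) ω := by
    intro ω
    rw [Set.ncard_eq_toFinset_card']
    simp [Set.indicator_apply, Finset.sum_boole]
  simp only [AccurateRun, hcount]
  exact measurableSet_le measurable_const
    (Finset.measurable_sum _ fun j _ => measurable_const.indicator (hround j))

lemma measurableSet_reconstructionFails (η : A.Coins) (S : Finset (Fin (2 * n))) :
    MeasurableSet {ω | ReconstructionFails O A ω η S} := by
  classical
  have ht := measurable_transcript O A η (sample A η S) ℓ
  have hz : ∀ z, MeasurableSet {ω | z ∈ A.output η (transcript O A ω η (sample A η S) ℓ).1} :=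
    fun z => (A.measurable_output z).preimage
      (measurable_const.prodMk (measurable_fst.comp ht))
  have hout : ∀ X : Finset (Cube d),
      MeasurableSet {ω | A.output η (transcript O A ω η (sample A η S) ℓ).1 = X} := by
    intro X
    have : {ω | A.output η (transcript O A ω η (sample A η S) ℓ).1 = X} =
        ⋂ z, {ω | z ∈ A.output η (transcript O A ω η (sample A η S) ℓ).1 ↔ z ∈ X} := by
      ext ω
      simp [Finset.ext_iff]
    rw [this]
    refine MeasurableSet.iInter fun z => ?_
    by_cases h : z ∈ X
    · simpa [h] using hz z
    · simp only [h, iff_false]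
      exact (hz z).compl
  have : {ω | ReconstructionFails O A ω η S} =
      ⋃ X : {X : Finset (Cube d) // (n : ℝ) / 100 < ((symmDiff (sample A η S) X).card : ℝ)},
        {ω | A.output η (transcript O A ω η (sample A η S) ℓ).1 = X} := by
    ext ω
    simp [ReconstructionFails]
  rw [this]
  exact MeasurableSet.iUnion fun X => hout X

end Transcript

/-! ### The attack: keys, coins, data points and queries -/

variable {n d ℓ : ℕ} {ν lam err B : ℝ}

/-- The secret keys of the users, one bit for each round. -/
abbrev Keys (n ℓ : ℕ) : Type := Fin (2 * n) → Fin ℓ → Bool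

/-- The coins of the attack: the keys and the rounds of the code. -/
structure AttackCoins (C : Code (2 * n) ν lam err B) (ℓ : ℕ) : Type where
  keys : Keys n ℓ
  rounds : Fin ℓ → C.Round

section Coins

variable (C : Code (2 * n) ν lam err B)

/-- The coins as a pair. -/
def AttackCoins.equivProd : Keys n ℓ × (Fin ℓ → C.Round) ≃ AttackCoins C ℓ where
  toFun p := ⟨p.1, p.2⟩
  invFun η := (η.keys, η.rounds)

instance : Fintype (AttackCoins C ℓ) := Fintype.ofEquiv _ (AttackCoins.equivProd C)

instance : MeasurableSpace (AttackCoins C ℓ) := ⊤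

instance : DiscreteMeasurableSpace (AttackCoins C ℓ) := ⟨fun _ => trivial⟩

/-- The probability of the coins `η`. -/
noncomputable def coinWt (η : AttackCoins C ℓ) : ℝ :=
  (Fintype.card (Keys n ℓ) : ℝ)⁻¹ * ∏ j, C.roundWt (η.rounds j)

lemma coinWt_nonneg (η : AttackCoins C ℓ) : 0 ≤ coinWt C η :=
  mul_nonneg (by positivity) (prod_nonneg fun _ _ => C.roundWt_nonneg _)

/-- The law of the coins of the attack. -/
noncomputable def coinLaw (ℓ : ℕ) : Measure (AttackCoins C ℓ) :=
  ∑ η, ENNReal.ofReal (coinWt C η) • Measure.dirac η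

open Classical in
lemma coinLaw_apply (E : AttackCoins C ℓ → Prop) :
    coinLaw C ℓ {η | E η} = ENNReal.ofReal ((Fintype.card (Keys n ℓ) : ℝ)⁻¹ *
      ∑ k : Keys n ℓ, wProb C.roundWt fun x => E ⟨k, x⟩) := by
  have h1 : coinLaw C ℓ {η | E η} =
      ENNReal.ofReal (∑ η, coinWt C η * if E η then 1 else 0) := by
    rw [coinLaw, Measure.finsetSum_apply, ENNReal.ofReal_sum_of_nonneg]
    · refine sum_congr rfl fun η _ => ?_
      rw [Measure.smul_apply, Measure.dirac_apply, smul_eq_mul]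
      by_cases h : E η <;> simp [h]
    · intro η _
      exact mul_nonneg (coinWt_nonneg C η) (by positivity)
  rw [h1]
  congr 1
  rw [mul_sum]
  rw [← (AttackCoins.equivProd C).sum_comp, Fintype.sum_prod_type]
  refine sum_congr rfl fun k _ => ?_
  simp only [wProb, wExp, mul_sum, coinWt, AttackCoins.equivProd, Equiv.coe_fn_mk]
  exact sum_congr rfl fun x _ => mul_assoc _ _ _

/-- The keys may be masked by a function of the rounds. -/
lemma coinLaw_le (E : AttackCoins C ℓ → Prop) (mask : (Fin ℓ → C.Round) → Keys n ℓ) {p : ℝ}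
    (h : ∀ k : Keys n ℓ,
      wProb C.roundWt (fun x => E ⟨fun i t => xor (k i t) (mask x i t), x⟩) ≤ p) :
    coinLaw C ℓ {η | E η} ≤ ENNReal.ofReal p := by
  classical
  rw [coinLaw_apply]
  refine ENNReal.ofReal_le_ofReal ?_
  have hswap : ∑ k : Keys n ℓ, wProb C.roundWt (fun x => E ⟨k, x⟩) =
      ∑ k : Keys n ℓ,
        wProb C.roundWt (fun x => E ⟨fun i t => xor (k i t) (mask x i t), x⟩) := by
    simp only [wProb, wExp]
    rw [sum_comm, sum_comm (s := univ) (t := univ)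
      (f := fun (k : Keys n ℓ) (x : Fin ℓ → C.Round) => (∏ j, C.roundWt (x j)) *
        if E ⟨fun i t => xor (k i t) (mask x i t), x⟩ then (1 : ℝ) else 0)]
    refine sum_congr rfl fun x _ => ?_
    -- One-time pad: for fixed rounds, XOR with the mask permutes the uniform keys.
    have hinv : Involutive fun (k : Keys n ℓ) => (fun i t => xor (k i t) (mask x i t)) := by
      intro k
      funext i t
      simp
    exact (Fintype.sum_equiv hinv.toPerm _ _ fun k => rfl).symm
  have hcard : (0 : ℝ) < Fintype.card (Keys n ℓ) := by exact_mod_cast Fintype.card_pos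
  rw [hswap, inv_mul_le_iff₀ hcard, ← nsmul_eq_mul, ← card_univ]
  exact sum_le_card_nsmul _ _ _ fun k _ => h k

instance : IsProbabilityMeasure (coinLaw C ℓ) := by
  classical
  constructor
  have h := coinLaw_apply C (ℓ := ℓ) (fun _ => True)
  have h1 : wProb C.roundWt (fun _ : Fin ℓ → C.Round => True) = 1 := by
    simp [wProb, wExp_one C.sum_roundWt]
  have hcard : (Fintype.card (Keys n ℓ) : ℝ) ≠ 0 := by exact_mod_cast Fintype.card_ne_zero
  rw [Set.ofPred_true] at h
  rw [h]
  simp only [h1, sum_const, card_univ, nsmul_eq_mul, mul_one, inv_mul_cancel₀ hcard,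
    ENNReal.ofReal_one]

end Coins

/-- The `t`-th bit of `z`. -/
def bitAt (z : Cube d) (t : ℕ) : Bool := if h : t < d then z ⟨t, h⟩ else false

/-- The data point of user `i`: a unary encoding of `i`, followed by the key of `i`. -/
def point (k : Keys n ℓ) (i : Fin (2 * n)) : Cube d := fun t =>
  if (t : ℕ) < 2 * n then decide ((t : ℕ) = i) else if h : (t : ℕ) < ℓ then k i ⟨t, h⟩ else false

open Classical in
/-- The user whose data point is `z`. -/
noncomputable def userOf (n : ℕ) (z : Cube d) : Option (Fin (2 * n)) :=
  if h : ∃ i : Fin (2 * n), bitAt z i = true then some h.choose else none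

/-- The sign of an answer. -/
noncomputable def signOf (a : Answer) : ℝ := if 0 < (a : ℝ) then 1 else -1

/-- The signs of a sequence of answers. -/
noncomputable def signs {j : ℕ} (a : Fin j → Answer) (t : ℕ) : ℝ :=
  if h : t < j then signOf (a ⟨t, h⟩) else 1

/-- The bit `b` as a value of a query. -/
def bitValue (b : Bool) : Set.Icc (-1 : ℝ) 1 :=
  ⟨if b then 1 else -1, by cases b <;> norm_num⟩

/-- The zero value of a query. -/
def zeroValue : Set.Icc (-1 : ℝ) 1 := ⟨0, by norm_num⟩

/-- The query of round `j`, after the answers `a`: a user whose score does not exceed `σ` gets a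
bit of the code, which is encrypted by the key, and other users get zero. -/
noncomputable def attackQuery (C : Code (2 * n) ν lam err B) (σ : ℝ) (η : AttackCoins C ℓ) (j : ℕ)
    (a : Fin j → Answer) : Query d := fun z =>
  if h : j < ℓ then
    match userOf n z with
    -- Never reached at the data point of a user, so the value is irrelevant.
    | none => zeroValue
    | some i =>
      -- The first `2 * n` coordinates hold the unary index and no key bit, so those rounds are
      -- idle. At the point of user `i`, `bitAt z j` equals the key bit and cancels it, leaving the
      -- bit of the code.
      if 2 * n ≤ j ∧ C.total σ (2 * n) η.rounds (signs a) j i ≤ σ then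
        bitValue (xor (bitAt z j) (xor (η.keys i ⟨j, h⟩) ((η.rounds ⟨j, h⟩).2 i)))
      else zeroValue
  else zeroValue

lemma bitAt_point_of_lt (k : Keys n ℓ) (i : Fin (2 * n)) {t : ℕ} (ht : t < 2 * n) (hd : t < d) :
    bitAt (point k i : Cube d) t = decide (t = i) := by
  simp [bitAt, point, ht, hd]

lemma bitAt_point_of_le (k : Keys n ℓ) (i : Fin (2 * n)) {t : ℕ} (ht : 2 * n ≤ t) (hℓ : t < ℓ)
    (hd : t < d) : bitAt (point k i : Cube d) t = k i ⟨t, hℓ⟩ := by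
  simp [bitAt, point, not_lt.2 ht, hℓ, hd]

lemma userOf_point (hd : 2 * n ≤ d) (k : Keys n ℓ) (i : Fin (2 * n)) :
    userOf n (point k i : Cube d) = some i := by
  classical
  have key : ∀ i' : Fin (2 * n), bitAt (point k i : Cube d) i' = true ↔ i' = i := by
    intro i'
    rw [bitAt_point_of_lt k i i'.2 (i'.2.trans_le hd), decide_eq_true_iff, Fin.ext_iff]
  have hex : ∃ i' : Fin (2 * n), bitAt (point k i : Cube d) i' = true := ⟨i, (key i).2 rfl⟩
  rw [userOf, dif_pos hex, (key _).1 hex.choose_spec]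

lemma measurable_signs {j : ℕ} (t : ℕ) : Measurable fun a : Fin j → Answer => signs a t := by
  unfold signs
  split_ifs with h
  · unfold signOf
    refine Measurable.ite (measurableSet_lt measurable_const ?_) measurable_const measurable_const
    exact measurable_subtype_coe.comp (measurable_pi_apply _)
  · exact measurable_const

lemma measurable_total (C : Code (2 * n) ν lam err B) (σ : ℝ) (r : ℕ) (x : Fin ℓ → C.Round)
    {m : ℕ} (j : ℕ) (i : Fin (2 * n)) :
    Measurable fun a : Fin m → Answer => C.total σ r x (signs a) j i := by
  induction j with
  | zero => exact measurable_const
  | succ j ih =>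
    simp only [Code.total]
    refine ih.add ?_
    split_ifs with h
    · by_cases hr : r ≤ j
      · simp only [hr, true_and]
        exact Measurable.ite (measurableSet_le ih measurable_const)
          ((measurable_signs j).mul_const _) measurable_const
      · simp only [hr, false_and, if_false]
        exact measurable_const
    · exact measurable_const

/-- The adversary that runs the interactive fingerprinting code `C` under the users' keys and
accuses the users whose score exceeds `σ`. -/
noncomputable abbrev attack (C : Code (2 * n) ν lam err B) (σ : ℝ) (hd : 2 * n ≤ d) :
    Adversary n d ℓ where
  Coins := AttackCoins C ℓ
  law := coinLaw C ℓ
  points η := point η.keys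
  points_injective η i i' h := by
    have := userOf_point hd η.keys i
    rw [h, userOf_point hd] at this
    exact (Option.some.inj this).symm
  measurable_points := Measurable.of_discrete
  ask j η a := attackQuery C σ η j a
  measurable_ask j := by
    refine measurable_from_prod_countable_right fun η => measurable_pi_iff.2 fun z => ?_
    unfold attackQuery
    by_cases h : j < ℓ
    · simp only [h, dif_pos]
      cases userOf n z with
      | none => exact measurable_const
      | some i =>
        by_cases hr : 2 * n ≤ j
        · simp only [hr, true_and]
          exact Measurable.ite (measurableSet_le (measurable_total C σ _ _ j i) measurable_const)
            measurable_const measurable_const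
        · simp only [hr, false_and, if_false]
          exact measurable_const
    · simp only [h, dif_neg, not_false_eq_true]
      exact measurable_const
  output η a := (univ.filter fun i => σ < C.total σ (2 * n) η.rounds (signs a) ℓ i).image (point η.keys)
  output_subset η a := image_subset_image (filter_subset _ _)
  measurable_output z := by
    refine measurableSet_setOfPred.2 (measurable_from_prod_countable_right fun η =>
      measurableSet_setOfPred.1 ?_)
    have : {a : Fin ℓ → Answer | z ∈ (univ.filter fun i =>
        σ < C.total σ (2 * n) η.rounds (signs a) ℓ i).image (point η.keys)} =
        ⋃ i : {i : Fin (2 * n) // point η.keys i = z},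
          {a | σ < C.total σ (2 * n) η.rounds (signs a) ℓ i} := by
      ext a
      simp [and_comm]
    rw [this]
    exact MeasurableSet.iUnion fun i =>
      measurableSet_lt measurable_const (measurable_total C σ _ _ ℓ i)

open NonPrivacy

/-- The coins of the attack whose keys are masked by the bits of the users outside `S`. -/
def maskedCoins (C : Code (2 * n) ν lam err B) (S : Finset (Fin (2 * n))) (k : Keys n ℓ)
    (x : Fin ℓ → C.Round) : AttackCoins C ℓ :=
  ⟨fun i t => xor (k i t) (if i ∈ S then false else (x t).2 i), x⟩

lemma signs_transcript (O : Oracle.{u} d) (A : Adversary n d ℓ) (ω : O.Coins) (η : A.Coins)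
    (X : Finset (Cube d)) {j t : ℕ} (ht : t < j) :
    signs (transcript O A ω η X j).1 t = signOf (roundAnswer O A ω η X t) := by
  simp [signs, ht, transcript_fst]

/-! ### Masked keys make the signs causal -/

section Masked

variable (C : Code (2 * n) ν lam err B) (σ : ℝ) (hd : 2 * n ≤ d) (O : Oracle.{u} d) (ω : O.Coins)
  (S : Finset (Fin (2 * n))) (k : Keys n ℓ)

/-- The mask changes only keys outside `S`, so the oracle's sample stays fixed while the rounds
vary. -/
lemma sample_maskedCoins (x : Fin ℓ → C.Round) :
    sample (attack (ℓ := ℓ) C σ hd) (maskedCoins C S k x) S = S.image (point k) := by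
  refine image_congr fun i hi => ?_
  have hi' : i ∈ S := hi
  funext t
  simp [maskedCoins, point, hi']

/-- The masked query of round `j` depends only on the earlier rounds and on the current bits of the
users of `S` whose score does not exceed `σ`. -/
lemma attackQuery_maskedCoins_congr {x x' : Fin ℓ → C.Round} {j : ℕ} (a : Fin j → Answer)
    (hx : ∀ t : Fin ℓ, (t : ℕ) < j → x t = x' t)
    (hj : ∀ h : j < ℓ, ∀ i ∈ S, C.total σ (2 * n) x (signs a) j i ≤ σ →
      (x ⟨j, h⟩).2 i = (x' ⟨j, h⟩).2 i) :
    (attackQuery C σ (maskedCoins C S k x) j a : Query d) =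
      attackQuery C σ (maskedCoins C S k x') j a := by
  have htot : C.total σ (2 * n) x (signs a) j = C.total σ (2 * n) x' (signs a) j :=
    C.total_congr hx fun _ _ _ => rfl
  funext z
  unfold attackQuery
  by_cases h : j < ℓ
  · simp only [h, dif_pos]
    cases userOf n z with
    | none => rfl
    | some i =>
      simp only [maskedCoins, ← htot]
      by_cases hact : 2 * n ≤ j ∧ C.total σ (2 * n) x (signs a) j i ≤ σ
      · simp only [hact, and_self, if_true]
        by_cases hi : i ∈ S
        · simp only [hi, if_true, hj h i hi hact.2]
        -- Outside `S` the mask cancels the bit of the code, so the query carries the bare key `k`.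
        · simp [hi]
      · simp only [hact, if_false]
  · simp [h]

lemma transcript_maskedCoins_congr {x x' : Fin ℓ → C.Round} {j : ℕ}
    (hx : ∀ t : Fin ℓ, (t : ℕ) < j → x t = x' t) (X : Finset (Cube d)) :
    transcript O (attack (ℓ := ℓ) C σ hd) ω (maskedCoins C S k x) X j =
      transcript O (attack (ℓ := ℓ) C σ hd) ω (maskedCoins C S k x') X j := by
  induction j with
  | zero => rfl
  | succ j ih =>
    have ih' := ih fun t ht => hx t (ht.trans j.lt_succ_self)
    have hq : attackQuery (d := d) C σ (maskedCoins C S k x) j =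
        attackQuery C σ (maskedCoins C S k x') j := by
      funext a
      exact attackQuery_maskedCoins_congr C σ S k a (fun t ht => hx t (ht.trans j.lt_succ_self))
        fun h i _ _ => by rw [hx ⟨j, h⟩ j.lt_succ_self]
    simp only [transcript, ih', hq]

/-- The signs of the answers in the game with masked keys. -/
noncomputable def maskedSign (x : Fin ℓ → C.Round) (t : ℕ) : ℝ :=
  signOf (roundAnswer O (attack (ℓ := ℓ) C σ hd) ω (maskedCoins C S k x) (S.image (point k)) t)

/-- With `ω` fixed the oracle is deterministic: the history depends on the earlier rounds, and the
new query on them and on the current bits of the active users of `S`. -/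
lemma causal_maskedSign : C.Causal σ (2 * n) S (maskedSign C σ hd O ω S k) where
  sq_eq_one x j := by
    unfold maskedSign signOf
    split_ifs <;> norm_num
  congr x x' j hx hj := by
    have ht := transcript_maskedCoins_congr C σ hd O ω S k (j := j)
      (fun t ht => hx t ht) (S.image (point k))
    have hq : attackQuery (d := d) C σ (maskedCoins C S k x) j
        (transcript O (attack (ℓ := ℓ) C σ hd) ω (maskedCoins C S k x') (S.image (point k)) j).1 =
        attackQuery C σ (maskedCoins C S k x') j
        (transcript O (attack (ℓ := ℓ) C σ hd) ω (maskedCoins C S k x')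
          (S.image (point k)) j).1 := by
      refine attackQuery_maskedCoins_congr C σ S k _ (fun t ht => hx t ht) fun h i hi hle => ?_
      refine hj i hi (le_of_eq_of_le ?_ hle)
      rw [← ht]
      refine congrFun (C.total_congr (fun _ _ => rfl) fun t htj _ => ?_) i
      exact (signs_transcript O (attack C σ hd) ω (maskedCoins C S k x) _ htj).symm
    simp only [maskedSign, roundAnswer, transcript, Fin.snoc_last, ht, hq]

end Masked

/-! ### Deterministic analysis of an accurate run -/

section Analysis

variable (C : Code (2 * n) ν lam err B) (σ : ℝ) (hd : 2 * n ≤ d) (O : Oracle.{u} d) (ω : O.Coins)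
  (S : Finset (Fin (2 * n)))

/-- The signs of the answers in the game. -/
noncomputable def gameSign (η : AttackCoins C ℓ) (t : ℕ) : ℝ :=
  signOf (roundAnswer O (attack (ℓ := ℓ) C σ hd) ω η (sample (attack (ℓ := ℓ) C σ hd) η S) t)

lemma card_sample (A : Adversary n d ℓ) (η : A.Coins) : (sample A η S).card = S.card :=
  card_image_of_injective _ (A.points_injective η)

lemma roundQuery_attack (η : AttackCoins C ℓ) {j : ℕ} (hj : j < ℓ) (hr : 2 * n ≤ j)
    (hℓ : ℓ ≤ d) (i : Fin (2 * n)) :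
    roundQuery O (attack (ℓ := ℓ) C σ hd) ω η (sample (attack (ℓ := ℓ) C σ hd) η S) j
        (point η.keys i) =
      if C.total σ (2 * n) η.rounds (gameSign C σ hd O ω S η) j i ≤ σ then
        bitValue ((η.rounds ⟨j, hj⟩).2 i) else zeroValue := by
  have htot : C.total σ (2 * n) η.rounds (signs (transcript O (attack (ℓ := ℓ) C σ hd) ω η
      (sample (attack (ℓ := ℓ) C σ hd) η S) j).1) j =
      C.total σ (2 * n) η.rounds (gameSign C σ hd O ω S η) j :=
    C.total_congr (fun _ _ => rfl) fun t ht _ =>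
      signs_transcript O (attack C σ hd) ω η _ ht
  change attackQuery C σ η j (transcript O (attack (ℓ := ℓ) C σ hd) ω η
      (sample (attack (ℓ := ℓ) C σ hd) η S) j).1 (point η.keys i) = _
  simp only [attackQuery, hj, dif_pos, userOf_point hd, htot, hr, true_and,
    bitAt_point_of_le η.keys i hr hj (hj.trans_le hℓ)]
  simp

/-- In a constant round of an accurate answer, the sign of the answer agrees with the bit, as long
as many users of the sample are still active. -/
lemma align_gameSign_ne (η : AttackCoins C ℓ) (hn : 1 ≤ n) (hS : S.card = n) (hℓ : ℓ ≤ d)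
    (hη : ∀ j, C.roundWt (η.rounds j) ≠ 0)
    (hact : (n : ℝ) / 200 < ((S.filter fun i =>
      C.total σ (2 * n) η.rounds (gameSign C σ hd O ω S η) ℓ i ≤ σ).card : ℝ))
    (j : Fin ℓ) (hr : 2 * n ≤ (j : ℕ))
    (hacc : |(roundAnswer O (attack (ℓ := ℓ) C σ hd) ω η
        (sample (attack (ℓ := ℓ) C σ hd) η S) j : ℝ) -
      NonPrivacy.average (roundQuery O (attack (ℓ := ℓ) C σ hd) ω η
        (sample (attack (ℓ := ℓ) C σ hd) η S) j) (sample (attack (ℓ := ℓ) C σ hd) η S)| ≤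
      1 / 1000) :
    Code.align (η.rounds j).1 (gameSign C σ hd O ω S η j) ≠ -1 := by
  rcases hτ : (η.rounds j).1 with b | k
  swap
  · norm_num [Code.align]
  set s := gameSign C σ hd O ω S η with hs
  set act := S.filter fun i => C.total σ (2 * n) η.rounds s j i ≤ σ with hactdef
  have hnpos : (0 : ℝ) < n := by exact_mod_cast hn
  -- Freezing is permanent, so the users active at the end are active in round `j`.
  have hmono : (n : ℝ) / 200 < act.card := by
    refine hact.trans_le ?_
    norm_cast
    refine card_le_card fun i hi => ?_
    rw [mem_filter] at hi ⊢
    exact ⟨hi.1, C.total_le_of_le j.2.le hi.2⟩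
  have hbit : ∀ i, (η.rounds j).2 i = b := fun i => by
    have h1 := hη j
    rw [show η.rounds j = (.inl b, (η.rounds j).2) from Prod.ext hτ rfl] at h1
    exact C.bit_eq_of_roundWt_ne_zero h1 i
  have havg : NonPrivacy.average (roundQuery O (attack (ℓ := ℓ) C σ hd) ω η
        (sample (attack (ℓ := ℓ) C σ hd) η S) j) (sample (attack (ℓ := ℓ) C σ hd) η S) =
      act.card / n * (if b then 1 else -1) := by
    unfold NonPrivacy.average
    rw [card_sample, hS]
    have hsum : ∑ z ∈ sample (attack (ℓ := ℓ) C σ hd) η S, ((roundQuery O (attack (ℓ := ℓ) C σ hd)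
        ω η (sample (attack (ℓ := ℓ) C σ hd) η S) j z : Set.Icc (-1 : ℝ) 1) : ℝ) =
        act.card * (if b then 1 else -1) := by
      have himage := sum_image (s := S) (g := (attack (d := d) (ℓ := ℓ) C σ hd).points η)
        (f := fun z => ((roundQuery O (attack (ℓ := ℓ) C σ hd)
          ω η (sample (attack (ℓ := ℓ) C σ hd) η S) j z : Set.Icc (-1 : ℝ) 1) : ℝ))
        ((attack (d := d) (ℓ := ℓ) C σ hd).points_injective η).injOn
      refine himage.trans ?_
      have hterm : ∀ i ∈ S, ((roundQuery O (attack (ℓ := ℓ) C σ hd)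
          ω η (sample (attack (ℓ := ℓ) C σ hd) η S) j (point η.keys i) : Set.Icc (-1 : ℝ) 1) : ℝ) =
          if C.total σ (2 * n) η.rounds s j i ≤ σ then (if b then 1 else -1) else 0 := by
        intro i _
        rw [roundQuery_attack C σ hd O ω S η j.2 hr hℓ i, hbit i]
        split_ifs <;> simp_all [bitValue, zeroValue]
      refine (sum_congr rfl hterm).trans ?_
      rw [← sum_filter, sum_const, nsmul_eq_mul]
    rw [hsum]
    ring
  -- The sample average has absolute value above `1/200`; an error of `1/1000` cannot change its
  -- sign.
  have hfrac : (1 : ℝ) / 200 < act.card / n := by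
    rw [lt_div_iff₀ hnpos]
    linarith
  rw [havg, abs_le] at hacc
  have hsj : s j = signOf (roundAnswer O (attack (ℓ := ℓ) C σ hd) ω η
        (sample (attack (ℓ := ℓ) C σ hd) η S) j) := rfl
  rw [hsj]
  unfold signOf
  cases b
  · simp only [Bool.false_eq_true, if_false] at hacc
    rw [if_neg (by linarith [hacc.2])]
    norm_num [Code.align]
  · simp only [if_true] at hacc
    rw [if_pos (by linarith [hacc.1])]
    norm_num [Code.align]

/-- An accurate run with a failed reconstruction has many false accusations or few constant rounds
in which the sign of the answer is wrong. -/
lemma accurate_and_fails {β : ℝ} (η : AttackCoins C ℓ) (hn : 1 ≤ n) (hS : S.card = n) (hℓ : ℓ ≤ d)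
    (hη : ∀ j, C.roundWt (η.rounds j) ≠ 0)
    (hacc : AccurateRun O (attack (ℓ := ℓ) C σ hd) (1 / 1000) β ω η S)
    (hfail : ReconstructionFails O (attack (ℓ := ℓ) C σ hd) ω η S) :
    ((n : ℝ) / 200 < ((Sᶜ.filter fun i =>
      σ < C.total σ (2 * n) η.rounds (gameSign C σ hd O ω S η) ℓ i).card : ℝ)) ∨
    (((univ.filter fun j : Fin ℓ => 2 * n ≤ (j : ℕ) ∧
      Code.align (η.rounds j).1 (gameSign C σ hd O ω S η j) = -1).card : ℝ) ≤ β * ℓ) := by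
  classical
  set s := gameSign C σ hd O ω S η with hs
  by_contra hcon
  rw [not_or, not_lt, not_le] at hcon
  obtain ⟨hfalse, hwrong⟩ := hcon
  set acc := univ.filter fun i => σ < C.total σ (2 * n) η.rounds s ℓ i with haccdef
  have hout : (attack (d := d) (ℓ := ℓ) C σ hd).output η (transcript O (attack (ℓ := ℓ) C σ hd) ω η
      (sample (attack (ℓ := ℓ) C σ hd) η S) ℓ).1 = acc.image (point η.keys) := by
    have htot : C.total σ (2 * n) η.rounds (signs (transcript O (attack (ℓ := ℓ) C σ hd) ω η
        (sample (attack (ℓ := ℓ) C σ hd) η S) ℓ).1) ℓ = C.total σ (2 * n) η.rounds s ℓ :=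
      C.total_congr (fun _ _ => rfl) fun t ht _ =>
        signs_transcript O (attack C σ hd) ω η _ ht
    change (univ.filter fun i => σ < C.total σ (2 * n) η.rounds (signs (transcript O
      (attack (ℓ := ℓ) C σ hd) ω η (sample (attack (ℓ := ℓ) C σ hd) η S) ℓ).1) ℓ i).image
        (point η.keys) = _
    rw [htot]
  have hcard : (symmDiff (sample (attack (d := d) (ℓ := ℓ) C σ hd) η S)
      ((attack (d := d) (ℓ := ℓ) C σ hd).output η (transcript O (attack (ℓ := ℓ) C σ hd) ω η
      (sample (attack (ℓ := ℓ) C σ hd) η S) ℓ).1)).card =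
      (S \ acc).card + (acc \ S).card := by
    rw [hout]
    change (symmDiff (S.image (point η.keys)) (acc.image (point η.keys))).card = _
    rw [← image_symmDiff _ _ ((attack (d := d) (ℓ := ℓ) C σ hd).points_injective η),
      card_image_of_injective _ ((attack (d := d) (ℓ := ℓ) C σ hd).points_injective η)]
    rw [symmDiff_def, sup_eq_union, card_union_of_disjoint disjoint_sdiff_sdiff]
  have hfail' : (n : ℝ) / 100 < ((S \ acc).card : ℝ) + (acc \ S).card := by
    have h1 : (n : ℝ) / 100 < _ := hfail
    rw [hcard] at h1
    exact_mod_cast h1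
  have hfalse' : ((acc \ S).card : ℝ) ≤ n / 200 := by
    refine le_of_eq_of_le ?_ hfalse
    congr 2
    ext i
    simp [haccdef, and_comm]
  have hact : (n : ℝ) / 200 < ((S.filter fun i => C.total σ (2 * n) η.rounds s ℓ i ≤ σ).card : ℝ) := by
    have : S \ acc = S.filter fun i => C.total σ (2 * n) η.rounds s ℓ i ≤ σ := by
      ext i
      simp [haccdef]
    rw [← this]
    linarith
  have hacc' : (1 - β) * (ℓ : ℝ) ≤ ((univ.filter fun j : Fin ℓ =>
      |(roundAnswer O (attack (ℓ := ℓ) C σ hd) ω η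
        (sample (attack (ℓ := ℓ) C σ hd) η S) j : ℝ) -
      NonPrivacy.average (roundQuery O (attack (ℓ := ℓ) C σ hd) ω η
        (sample (attack (ℓ := ℓ) C σ hd) η S) j) (sample (attack (ℓ := ℓ) C σ hd) η S)| ≤
      1 / 1000).card : ℝ) := by
    have h1 := hacc
    simp only [AccurateRun, transcript_fst, transcript_snd] at h1
    rwa [Set.ncard_eq_toFinset_card', Set.toFinset_ofPred] at h1
  -- Wrong constant rounds are inaccurate. More than `β * ℓ` of them and at least `(1 - β) * ℓ`
  -- accurate rounds do not fit into `ℓ`.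
  have hdisj := card_union_of_disjoint (s := univ.filter fun j : Fin ℓ => 2 * n ≤ (j : ℕ) ∧
      Code.align (η.rounds j).1 (s j) = -1) (t := univ.filter fun j : Fin ℓ =>
      |(roundAnswer O (attack (ℓ := ℓ) C σ hd) ω η
        (sample (attack (ℓ := ℓ) C σ hd) η S) j : ℝ) -
      NonPrivacy.average (roundQuery O (attack (ℓ := ℓ) C σ hd) ω η
        (sample (attack (ℓ := ℓ) C σ hd) η S) j) (sample (attack (ℓ := ℓ) C σ hd) η S)| ≤
      1 / 1000) (by
    rw [disjoint_left]
    intro j h1 h2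
    rw [mem_filter] at h1 h2
    exact align_gameSign_ne C σ hd O ω S η hn hS hℓ hη hact j h1.2.1 h2.2 h1.2.2)
  have hle := hdisj ▸ card_le_univ (α := Fin ℓ) _
  rw [Fintype.card_fin] at hle
  have hle' := (Nat.cast_le (α := ℝ)).2 hle
  rw [Nat.cast_add] at hle'
  linarith

end Analysis

/-- After masking, the signs of the game are causal and both probabilistic bounds apply with `2 * n`
users. More than `n / 200` false accusations would put at least `σ ^ 2 * (n / 200)` into the sum of
squares, which `hfalse` makes unlikely; `hwrong` is the score budget, with `2 * n` idle rounds and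
`β * ℓ` wrong ones. -/
lemma coinLaw_accurate_and_fails_le (C : Code (2 * n) ν lam err B) {σ : ℝ} (hd : 2 * n ≤ d)
    (O : Oracle.{u} d) (ω : O.Coins) {S : Finset (Fin (2 * n))} (hn : 1 ≤ n) (hS : S.card = n)
    (hℓ0 : 0 < ℓ) (hℓ : ℓ ≤ d) {β t t' : ℝ} (ht : 0 < t) (ht' : 0 < t') (hν0 : 0 < ν) (hν1 : ν ≤ 1)
    (herr : 0 ≤ err) (hlam : 0 ≤ lam) (hσ : 0 ≤ σ) (hB : 0 ≤ B)
    (hfalse : t + 16 * ν * n * ℓ ≤ σ ^ 2 * (n / 200))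
    (hwrong : n * (σ + B) + ℓ * err + t' ≤ lam * (ℓ - 2 * n - 2 * (β * ℓ) - ν * ℓ)) :
    coinLaw C ℓ {η | AccurateRun O (attack (ℓ := ℓ) C σ hd) (1 / 1000) β ω η S ∧
      ReconstructionFails O (attack (ℓ := ℓ) C σ hd) ω η S} ≤
      ENNReal.ofReal (64 * n * (ν * ℓ) ^ 2 / t ^ 2 + B ^ 2 / (4 * ν * ℓ) +
        ℓ * (8 * ν * n + 8 * lam ^ 2) / t' ^ 2) := by
  have hSc : (Sᶜ.card : ℝ) = n := by
    rw [card_compl, hS, Fintype.card_fin]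
    norm_cast
    omega
  refine coinLaw_le C _ (fun x i t => if i ∈ S then false else (x t).2 i) fun k => ?_
  have hsgn := causal_maskedSign C σ hd O ω S k
  have h1 := hsgn.wProb_sum_total_sq_le hν0 (by omega) hℓ0 ht
  have h2 := hsgn.wProb_wrongCount_le hν1 herr hlam hσ hB (m := β * ℓ) ht'
    (by rw [hS]; push_cast; exact hwrong)
  rw [hSc] at h1
  rw [hS] at h2
  refine le_trans (wProb_mono_of_ne_zero C.roundWt_nonneg fun x hx hE => ?_)
    ((wProb_or_le C.roundWt_nonneg _ _).trans (add_le_add h1 h2))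
  have hsign : gameSign C σ hd O ω S (maskedCoins C S k x) = maskedSign C σ hd O ω S k x := by
    funext t
    simp only [gameSign, maskedSign, sample_maskedCoins]
  have hcase := accurate_and_fails C σ hd O ω S (maskedCoins C S k x) hn hS hℓ hx hE.1 hE.2
  rw [hsign] at hcase
  refine hcase.imp (fun hmany => ?_) fun hfew => ?_
  · have hsum : ((Sᶜ.filter fun i =>
        σ < C.total σ (2 * n) x (maskedSign C σ hd O ω S k x) ℓ i).card : ℝ) * σ ^ 2 ≤
        ∑ i ∈ Sᶜ, C.total σ (2 * n) x (maskedSign C σ hd O ω S k x) ℓ i ^ 2 := by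
      rw [← nsmul_eq_mul]
      refine (card_nsmul_le_sum _ (fun i =>
        C.total σ (2 * n) x (maskedSign C σ hd O ω S k x) ℓ i ^ 2) _ fun i hi => ?_).trans
        (sum_le_sum_of_subset_of_nonneg (filter_subset _ _) fun _ _ _ => sq_nonneg _)
      have := (mem_filter.1 hi).2
      gcongr
    refine le_trans ?_ hsum
    have := mul_le_mul_of_nonneg_right hmany.le (sq_nonneg σ)
    refine le_trans ?_ this
    push_cast
    linarith
  · refine le_of_eq_of_le ?_ hfew
    unfold Code.wrongCount
    congr!

/-! ### Choice of the parameters -/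

/-- The number of rounds of the attack on `n` samples, with `δ = 1/2 - β`. -/
noncomputable def attackLength (n : ℕ) (δ : ℝ) : ℕ := ⌈100000 * (n : ℝ) ^ 2 / δ ^ 4⌉₊

lemma le_attackLength (n : ℕ) (δ : ℝ) : 100000 * (n : ℝ) ^ 2 / δ ^ 4 ≤ attackLength n δ :=
  Nat.le_ceil _

lemma attackLength_le {n : ℕ} (hn : 1 ≤ n) {δ : ℝ} (hδ0 : 0 < δ) (hδ1 : δ ≤ 1 / 2) :
    (attackLength n δ : ℝ) ≤ 200000 * ((n : ℝ) ^ 2 / δ ^ 4) := by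
  have hn' : (1 : ℝ) ≤ n := by exact_mod_cast hn
  have h1 : 1 ≤ (n : ℝ) ^ 2 / δ ^ 4 := by
    rw [one_le_div (by positivity)]
    calc δ ^ 4 ≤ 1 ^ 4 := by gcongr; linarith
      _ ≤ (n : ℝ) ^ 2 := by rw [one_pow]; exact one_le_pow₀ hn'
  have h2 := Nat.ceil_lt_add_one (show 0 ≤ 100000 * (n : ℝ) ^ 2 / δ ^ 4 by positivity)
  rw [mul_div_assoc] at h2
  unfold attackLength
  rw [mul_div_assoc]
  linarith

/-- The attack itself needs only order `n ^ 2 / δ ^ 3` rounds; one factor `δ` is given away. -/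
lemma mul_sq_le_attackLength {n : ℕ} {δ : ℝ} (hδ0 : 0 < δ) (hδ1 : δ ≤ 1 / 2) :
    100000 * (n : ℝ) ^ 2 ≤ δ ^ 3 * attackLength n δ := by
  have h := le_attackLength n δ
  rw [div_le_iff₀ (by positivity)] at h
  calc _ ≤ _ := h
    _ = δ * (δ ^ 3 * attackLength n δ) := by ring
    _ ≤ 1 * (δ ^ 3 * attackLength n δ) := by gcongr; linarith
    _ = _ := one_mul _

lemma two_mul_le_attackLength {n : ℕ} (hn : 1 ≤ n) {δ : ℝ} (hδ0 : 0 < δ) (hδ1 : δ ≤ 1 / 2) :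
    2 * n ≤ attackLength n δ := by
  have hn' : (1 : ℝ) ≤ n := by exact_mod_cast hn
  have h := mul_sq_le_attackLength (n := n) hδ0 hδ1
  have h1 : δ ^ 3 * attackLength n δ ≤ 1 ^ 3 * attackLength n δ := by gcongr; linarith
  have : ((2 * n : ℕ) : ℝ) ≤ attackLength n δ := by
    push_cast
    nlinarith
  exact_mod_cast this

set_option maxHeartbeats 1000000 in
/-- For a suitable code and threshold, the attack reconstructs the sample in accurate runs. -/
lemma exists_attack {n d : ℕ} (hn : 1 ≤ n) {β : ℝ} (hβ0 : 0 ≤ β) (hβ1 : β < 1 / 2)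
    (hℓ : attackLength n (1 / 2 - β) ≤ d) (O : Oracle.{u} d) :
    ∃ A : Adversary n d (attackLength n (1 / 2 - β)), Countable A.Coins ∧
      MeasurableSingletonClass A.Coins ∧
      ∀ ω, ∀ S : Finset (Fin (2 * n)), S.card = n →
        A.law {η | AccurateRun O A (1 / 1000) β ω η S ∧ ReconstructionFails O A ω η S} ≤
          ENNReal.ofReal (66 / n) := by
  set δ := 1 / 2 - β with hδ
  have hδ0 : 0 < δ := by linarith
  have hδ1 : δ ≤ 1 / 2 := by linarith
  set ℓ := attackLength n δ with hℓdef
  have hn' : (1 : ℝ) ≤ n := by exact_mod_cast hn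
  have hn0 : (0 : ℝ) < n := by linarith
  have h2n : 2 * n ≤ ℓ := two_mul_le_attackLength hn hδ0 hδ1
  have hℓ0 : 0 < ℓ := by omega
  have hℓ0' : (0 : ℝ) < ℓ := by exact_mod_cast hℓ0
  have hlen : 100000 * (n : ℝ) ^ 2 ≤ δ ^ 3 * ℓ := mul_sq_le_attackLength hδ0 hδ1
  have hlen2 : 100000 * (n : ℝ) ^ 2 ≤ δ ^ 2 * ℓ :=
    hlen.trans (by
      have : δ ^ 3 ≤ δ ^ 2 := pow_le_pow_of_le_one hδ0.le (by linarith) (by norm_num)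
      gcongr)
  have hlen1 : 100000 * (n : ℝ) ^ 2 ≤ δ * ℓ :=
    hlen2.trans (by
      have : δ ^ 2 ≤ δ ^ 1 := pow_le_pow_of_le_one hδ0.le (by linarith) (by norm_num)
      rw [pow_one] at this
      gcongr)
  have hnn : (n : ℝ) ≤ (n : ℝ) ^ 2 := by nlinarith
  -- Makes the end error `4 * (2n) * θ ^ 2` equal to `δ / 10`, matching the grid error `η`.
  set θ := Real.sqrt (δ / (80 * n)) with hθ
  have hθ0 : 0 < θ := Real.sqrt_pos.2 (by positivity)
  have hθsq : θ ^ 2 = δ / (80 * n) := Real.sq_sqrt (by positivity)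
  have hθ1 : θ ≤ 1 / 8 := by
    rw [← abs_of_pos hθ0]
    refine abs_le_of_sq_le_sq ?_ (by norm_num)
    rw [hθsq, div_le_iff₀ (by positivity)]
    linarith
  set L := Real.pi / 2 - 2 * θ with hL
  have hL1 : 1 ≤ L := by linarith [Real.pi_gt_three]
  have hL2 : L ≤ 8 / 5 := by linarith [Real.pi_lt_d2]
  -- With `ν = δ / 2`, constant rounds leave a surplus `1 - 2 * β - ν = 3/2 * δ` per round; the idle
  -- rounds cost at most `δ / 4` of it.
  obtain ⟨C⟩ := exists_code (2 * n) (ν := δ / 2) (θ₀ := θ) (η := δ / 10) (by positivity)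
    (by linarith) hθ0 (by linarith [Real.pi_gt_three]) (by positivity)
  rw [← hL] at C
  set lam := 2 * (δ / 2) / (L * (1 - δ / 2)) with hlam
  set err := δ / 2 / L * (4 * ((2 * n : ℕ) : ℝ) * θ ^ 2 + δ / 10) with herr
  have herr' : err = δ ^ 2 / (10 * L) := by
    rw [herr, hθsq]
    push_cast
    field_simp
    norm_num
  have hLpos : 0 < L := by linarith
  have hden : 0 < 1 - δ / 2 := by linarith
  have hlamlow : δ / L ≤ lam := by
    rw [hlam, div_le_div_iff₀ hLpos (by positivity)]
    nlinarith [mul_pos hδ0 hLpos, mul_pos (mul_pos hδ0 hLpos) hδ0]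
  have hlamup : lam ≤ 4 / 3 * δ := by
    rw [hlam, div_le_iff₀ (by positivity)]
    have : 3 / 4 ≤ L * (1 - δ / 2) := by nlinarith
    nlinarith
  have hlam0 : 0 ≤ lam := by positivity
  have herr0 : 0 ≤ err := by positivity
  clear_value lam err L θ
  -- Equality in the false-accusation budget: `n * δ * ℓ * (1/2 + 8) = σ ^ 2 * n / 200`.
  set σ := Real.sqrt (1700 * δ * ℓ) with hσ
  have hσ0 : 0 ≤ σ := Real.sqrt_nonneg _
  have hσsq : σ ^ 2 = 1700 * δ * ℓ := Real.sq_sqrt (by positivity)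
  clear_value σ
  have hBsq : (2 / θ) ^ 2 = 320 * n / δ := by
    rw [div_pow, hθsq]
    field_simp
    norm_num
  have hBσ : 2 / θ ≤ σ := by
    rw [← abs_of_pos (show 0 < 2 / θ by positivity)]
    refine abs_le_of_sq_le_sq ?_ hσ0
    rw [hBsq, hσsq, div_le_iff₀ hδ0, show 1700 * δ * ℓ * δ = 1700 * (δ ^ 2 * ℓ) by ring]
    linarith
  have hnσ : 2 * n * σ ≤ 2 / 5 * (δ ^ 2 * ℓ) := by
    refine (le_abs_self _).trans (abs_le_of_sq_le_sq ?_ (by positivity))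
    calc (2 * n * σ) ^ 2 = 6800 * (n : ℝ) ^ 2 * (δ * ℓ) := by rw [mul_pow, hσsq]; ring
      _ ≤ 4 / 25 * (δ ^ 3 * ℓ) * (δ * ℓ) :=
          mul_le_mul_of_nonneg_right (by linarith) (by positivity)
      _ = _ := by ring
  refine ⟨attack C σ (h2n.trans hℓ), inferInstanceAs (Countable (AttackCoins C ℓ)),
    inferInstanceAs (MeasurableSingletonClass (AttackCoins C ℓ)), fun ω S hS => ?_⟩
  refine (coinLaw_accurate_and_fails_le C (h2n.trans hℓ) O ω hn hS hℓ0 hℓ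
    (t := n * (δ / 2 * ℓ)) (t' := δ ^ 2 * ℓ / (2 * L)) (by positivity) (by positivity)
    (by positivity) (by linarith) herr0 hlam0 hσ0 (by positivity) ?_ ?_).trans
    (ENNReal.ofReal_le_ofReal ?_)
  · rw [hσsq]
    linarith
  · have h1 : n * (σ + 2 / θ) ≤ 2 / 5 * (δ ^ 2 * ℓ) :=
      le_trans (by linarith [mul_le_mul_of_nonneg_left hBσ hn0.le]) hnσ
    have h2 : 5 / 4 * (δ * ℓ) ≤ ℓ - 2 * n - 2 * (β * ℓ) - δ / 2 * ℓ := by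
      have : β = 1 / 2 - δ := by linarith
      rw [this]
      linarith
    have h3 : δ / L * (5 / 4 * (δ * ℓ)) ≤ lam * (ℓ - 2 * n - 2 * (β * ℓ) - δ / 2 * ℓ) := by
      gcongr
    refine le_trans ?_ h3
    -- In units of `δ ^ 2 * ℓ / L` the score cap, the correlation error and the deviation take
    -- `13/20 + 1/10 + 1/2`, exactly the available `5/4`.
    have h4 : 2 / 5 * (δ ^ 2 * ℓ) ≤ 13 / 20 * (δ ^ 2 * ℓ / L) := by
      rw [mul_div_assoc', le_div_iff₀ hLpos]
      have : 0 ≤ δ ^ 2 * ℓ := by positivity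
      linarith [mul_le_mul_of_nonneg_left hL2 this]
    have h5 : ℓ * err = 1 / 10 * (δ ^ 2 * ℓ / L) := by
      rw [herr']
      field_simp
    have h6 : δ ^ 2 * ℓ / (2 * L) = 1 / 2 * (δ ^ 2 * ℓ / L) := by
      field_simp
    have h7 : δ / L * (5 / 4 * (δ * ℓ)) = 5 / 4 * (δ ^ 2 * ℓ / L) := by
      field_simp
    rw [h5, h6, h7]
    linarith
  · have h1 : 64 * n * (δ / 2 * ℓ) ^ 2 / (n * (δ / 2 * ℓ)) ^ 2 = 64 / (n : ℝ) := by
      field_simp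
    have h2 : (2 / θ) ^ 2 / (4 * (δ / 2) * ℓ) ≤ 1 / n := by
      rw [hBsq, div_div, div_le_div_iff₀ (by positivity) hn0,
        show 320 * (n : ℝ) * n = 320 * (n : ℝ) ^ 2 by ring,
        show 1 * (δ * (4 * (δ / 2) * ℓ)) = 2 * (δ ^ 2 * ℓ) by ring]
      linarith
    have h3 : ℓ * (8 * (δ / 2) * n + 8 * lam ^ 2) / (δ ^ 2 * ℓ / (2 * L)) ^ 2 ≤ 1 / n := by
      have h4 : lam ^ 2 ≤ δ * n := by
        calc lam ^ 2 ≤ (4 / 3 * δ) ^ 2 := by gcongr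
          _ ≤ δ * 1 := by nlinarith
          _ ≤ δ * n := by gcongr
      have h5 : ℓ * (8 * (δ / 2) * n + 8 * lam ^ 2) ≤ 12 * (δ * n * ℓ) := by
        linarith [mul_le_mul_of_nonneg_left h4 hℓ0'.le]
      have h6 : L ^ 2 ≤ 64 / 25 := by nlinarith
      rw [div_le_div_iff₀ (by positivity) hn0, one_mul, div_pow (δ ^ 2 * (ℓ : ℝ)), le_div_iff₀ (by positivity)]
      calc _ ≤ 12 * (δ * n * ℓ) * n * (2 * L) ^ 2 := by gcongr
        _ = 48 * (n : ℝ) ^ 2 * L ^ 2 * (δ * ℓ) := by ring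
        _ ≤ 48 * (n : ℝ) ^ 2 * (64 / 25) * (δ * ℓ) := by gcongr
        _ ≤ (δ ^ 3 * ℓ) * (δ * ℓ) :=
            mul_le_mul_of_nonneg_right (by linarith) (by positivity)
        _ = _ := by ring
    calc _ ≤ 64 / (n : ℝ) + 1 / n + 1 / n := by rw [h1]; gcongr
      _ = 66 / n := by ring

/-! ### Averaging over the coins of the oracle and the sample -/

lemma measurableSet_prod_of_countable {α β : Type*} [MeasurableSpace α] [MeasurableSpace β]
    [Countable β] [MeasurableSingletonClass β] {E : α → β → Prop}
    (h : ∀ b, MeasurableSet {a | E a b}) : MeasurableSet {p : α × β | E p.1 p.2} :=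
  measurableSet_setOfPred.2 (measurable_from_prod_countable_left fun b =>
    measurableSet_setOfPred.1 (h b))

lemma card_powersetCard_pos (n : ℕ) :
    (0 : ℝ) < (powersetCard n (univ : Finset (Fin (2 * n)))).card := by
  rw [card_powersetCard, card_univ, Fintype.card_fin]
  exact_mod_cast Nat.choose_pos (by omega)

/-- Fubini: a bound uniform in the coins of the oracle and in `S` survives averaging over both. -/
lemma prob_le (O : Oracle.{u} d) (A : Adversary n d ℓ)
    {E : O.Coins → A.Coins → Finset (Fin (2 * n)) → Prop} {p : ℝ} (hp : 0 ≤ p)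
    (hE : ∀ S : Finset (Fin (2 * n)), S.card = n →
      MeasurableSet {q : O.Coins × A.Coins | E q.1 q.2 S})
    (h : ∀ ω, ∀ S : Finset (Fin (2 * n)), S.card = n →
      A.law {η | E ω η S} ≤ ENNReal.ofReal p) : prob O A E ≤ p := by
  unfold prob
  rw [div_le_iff₀ (card_powersetCard_pos n), mul_comm p, ← nsmul_eq_mul]
  refine sum_le_card_nsmul _ _ _ fun S hS => ?_
  have hS' := (mem_powersetCard.1 hS).2
  refine ENNReal.toReal_le_of_le_ofReal hp ?_
  rw [Measure.prod_apply (hE S hS')]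
  calc _ ≤ ∫⁻ _ : O.Coins, ENNReal.ofReal p ∂O.law := lintegral_mono fun ω => h ω S hS'
    _ = _ := by simp

lemma prob_le_add (O : Oracle.{u} d) (A : Adversary n d ℓ)
    {E F : O.Coins → A.Coins → Finset (Fin (2 * n)) → Prop}
    (hE : ∀ S : Finset (Fin (2 * n)), MeasurableSet {q : O.Coins × A.Coins | E q.1 q.2 S}) :
    prob O A F ≤ (1 - prob O A E) + prob O A (fun ω η S => E ω η S ∧ F ω η S) := by
  have hc := card_powersetCard_pos n
  unfold prob
  rw [one_sub_div hc.ne', ← add_div]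
  gcongr
  rw [← nsmul_one, ← sum_const, ← sum_sub_distrib, ← sum_add_distrib]
  refine sum_le_sum fun S _ => ?_
  rw [← probReal_compl_eq_one_sub (hE S)]
  refine (measureReal_mono fun q hq => ?_).trans (measureReal_union_le _ _)
  by_cases h : E q.1 q.2 S
  · exact Or.inr ⟨h, hq⟩
  · exact Or.inl h

/-- The attack on a sample-accurate oracle. -/
lemma exists_adversary {n d : ℕ} (hn : 1 ≤ n) {β γ : ℝ} (hβ0 : 0 ≤ β) (hβ1 : β < 1 / 2)
    (hℓ : attackLength n (1 / 2 - β) ≤ d) (O : Oracle.{u} d)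
    (hO : SampleAccurate O n (attackLength n (1 / 2 - β)) (1 / 1000) β γ) :
    ∃ A : Adversary n d (attackLength n (1 / 2 - β)),
      prob O A (fun ω η S => AccurateRun O A (1 / 1000) β ω η S ∧
        ReconstructionFails O A ω η S) ≤ 66 / n ∧
      prob O A (ReconstructionFails O A) ≤ γ + 66 / n := by
  obtain ⟨A, _, _, hA⟩ := exists_attack hn hβ0 hβ1 hℓ O
  have hacc : ∀ S : Finset (Fin (2 * n)), MeasurableSet
      {q : O.Coins × A.Coins | AccurateRun O A (1 / 1000) β q.1 q.2 S} := fun S =>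
    measurableSet_prod_of_countable fun η => measurableSet_accurateRun O A _ _ η S
  have hfail : ∀ S : Finset (Fin (2 * n)), MeasurableSet
      {q : O.Coins × A.Coins | ReconstructionFails O A q.1 q.2 S} := fun S =>
    measurableSet_prod_of_countable fun η => measurableSet_reconstructionFails O A η S
  have h1 := prob_le O A (E := fun ω η S => AccurateRun O A (1 / 1000) β ω η S ∧
    ReconstructionFails O A ω η S) (p := 66 / n) (by positivity)
    (fun S _ => (hacc S).inter (hfail S)) hA
  refine ⟨A, h1, ?_⟩
  have h2 := prob_le_add O A (F := ReconstructionFails O A) hacc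
  linarith [hO A]

end Fingerprint


theorem mainTheorem5 :
    ∃ (ℓ : ℕ → ℝ → ℕ) (C : ℝ) (ε : ℝ → ℕ → ℝ),
      -- `ℓ(2n, β) = O(n² / (1/2 - β)⁴)` with an absolute constant
      (∀ (n : ℕ) (β : ℝ), 1 ≤ n → 0 ≤ β → β < 1 / 2 →
        (ℓ (2 * n) β : ℝ) ≤ C * ((n : ℝ) ^ 2 / (1 / 2 - β) ^ 4)) ∧
      -- `ε(β, n) = o_n(1)`
      (∀ β : ℝ, 0 ≤ β → β < 1 / 2 → Filter.Tendsto (ε β) Filter.atTop (nhds 0)) ∧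
      -- for every `γ` (for instance `γ = 1/2`), an adversary reconstructs the sample of a
      -- `(1/1000, β, γ)`-sample-accurate oracle: an accurate run with failed reconstruction has
      -- probability `o_n(1)`, and the reconstruction fails with probability at most `γ + o_n(1)`
      (∀ (n d : ℕ) (β γ : ℝ), 1 ≤ n → 0 ≤ β → β < 1 / 2 → ℓ (2 * n) β ≤ d →
        ∀ O : Oracle.{u} d, SampleAccurate O n (ℓ (2 * n) β) (1 / 1000) β γ →
          ∃ A : Adversary n d (ℓ (2 * n) β),
            NonPrivacy.prob O A (fun ω η S =>
                NonPrivacy.AccurateRun O A (1 / 1000) β ω η S ∧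
                  NonPrivacy.ReconstructionFails O A ω η S) ≤ ε β n ∧
              NonPrivacy.prob O A (NonPrivacy.ReconstructionFails O A) ≤ γ + ε β n) ∧
      -- `(1/1000, β, o_n(1))`-sample-accurate oracles are blatantly non-private
      (∀ (β : ℝ) (d : ℕ → ℕ) (γ : ℕ → ℝ), 0 ≤ β → β < 1 / 2 →
        (∀ n : ℕ, 1 ≤ n → ℓ (2 * n) β ≤ d n) →
        Filter.Tendsto γ Filter.atTop (nhds 0) →
        ∀ O : (n : ℕ) → Oracle.{u} (d n),
          (∀ n : ℕ, 1 ≤ n → SampleAccurate (O n) n (ℓ (2 * n) β) (1 / 1000) β (γ n)) →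
          BlatantlyNonPrivate d (fun n => ℓ (2 * n) β) O) := by
  -- The length in the theorem takes the number `2 * n` of users, `attackLength` the sample size.
  have hhalf : ∀ n : ℕ, 2 * n / 2 = n := fun n => by omega
  refine ⟨fun N β => Fingerprint.attackLength (N / 2) (1 / 2 - β), 200000, fun _ n => 66 / n,
    ?_, ?_, ?_, ?_⟩
  · intro n β hn hβ0 hβ1
    simp only [hhalf]
    exact Fingerprint.attackLength_le hn (by linarith) (by linarith)
  · intro β _ _
    exact tendsto_const_div_atTop_nhds_zero_nat 66
  · intro n d β γ hn hβ0 hβ1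
    beta_reduce
    rw [hhalf n]
    exact fun hd O hO => Fingerprint.exists_adversary hn hβ0 hβ1 hd O hO
  · intro β d γ hβ0 hβ1 hd hγ O hO
    simp only [hhalf] at hd hO ⊢
    refine ⟨fun n => γ n + 66 / n, ?_, fun n hn => ?_⟩
    · simpa using hγ.add (tendsto_const_div_atTop_nhds_zero_nat (66 : ℝ))
    · obtain ⟨A, _, hA⟩ := Fingerprint.exists_adversary hn hβ0 hβ1 (hd n hn) (O n) (hO n hn)
      exact ⟨A, hA⟩
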